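/- Let $(\mathbf Z_i,\mathbf X_i)_{i\ge 1}$, with $\mathbf Z_i\in\mathbb R^p$ and $\mathbf X_i=(X_{i,1},X_{i,2})\in\mathbb R^2$, be i.i.d. Let $\mathbf Z_i$ have a density $f_{\mathbf Z}$ on $\mathbb R^p$ and take its values almost surely in a (measurable) set $\mathcal Z\subset\mathbb R^p$. Fix a regular version of the conditional law of $\mathbf X$ given $\mathbf Z=\mathbf z$, absolutely continuous with respect to Lebesgue measure for every $\mathbf z\in\mathcal Z$; all conditional probabilities and expectations below are computed from it. Let $W_{(i,j)}=2\cdot\mathbf 1\{(X_{j,1}-X_{i,1})(X_{j,2}-X_{i,2})>0\}-1$ and $$\tau_{1,2|\mathbf Z=\mathbf z}=\mathbb P\big((X_{2,1}-X_{1,1})(X_{2,2}-X_{1,2})>0\,|\,\mathbf Z_1=\mathbf Z_2=\mathbf z\big)-\mathbb P\big((X_{2,1}-X_{1,1})(X_{2,2}-X_{1,2})<0\,|\,\mathbf Z_1=\mathbf Z_2=\mathbf z\big).$$ Assume the single-index model $\tau_{1,2|\mathbf Z=\mathbf z}=g(\psi(\mathbf z)^T\beta^*)$ for all $\mathbf z\in\mathcal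 Z$, with $g:\mathbb R\to(-1,1)$, $\psi:\mathbb R^p\to\mathbb R^{p'}$ and $\beta^*\in\mathbb R^{p'}$. Put $$q(\mathbf x,\beta)=\tfrac12+\tfrac12 g(\psi(\mathbf x)^T\beta),\qquad \ell_\beta(w,\mathbf z)=\tfrac{1+w}2\log q(\mathbf z,\beta)+\tfrac{1-w}2\log(1-q(\mathbf z,\beta)),$$ $$p(\mathbf x,\mathbf y)=\mathbb P(W_{(1,2)}=1|\mathbf Z_1=\mathbf x,\mathbf Z_2=\mathbf y),\quad p(\mathbf x,\mathbf y,\mathbf z)=\mathbb P(W_{(1,2)}=W_{(1,3)}=1|\mathbf Z_1=\mathbf x,\mathbf Z_2=\mathbf y,\mathbf Z_3=\mathbf z),$$ $$\phi(\mathbf x,\mathbf y,\beta)=p(\mathbf x,\mathbf y)\log q(\mathbf x,\beta)+(1-p(\mathbf x,\mathbf y))\log(1-q(\mathbf x,\beta)).$$ Let $K$ be a compactly supported, square-integrable kernel on $\mathbb R^p$ of order $m\ge2$ ($\int K=1$ and the moments of total degree $1,\dots,m-1$ vanish), $K_h(\mathbf z)=K(\mathbf z/h)/h^p$, $h=h_n>0$,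 $h_n\to0$, $\lambda_n\ge0$, and $$L_n(\beta)=\frac1{n(n-1)}\sum_{1\le i\ne j\le n}K_h(\mathbf Z_i-\mathbf Z_j)\,\ell_\beta(W_{(i,j)},\mathbf Z_i),\qquad \hat\beta_n\in\arg\max_{\beta\in\mathbb R^{p'}}\{L_n(\beta)-\lambda_n|\beta|_1\},$$ where $\hat\beta_n$ is any maximizer whenever one exists, and is arbitrary otherwise. Regularity (R0): $f_{\mathbf Z}$ is $m$ times continuously differentiable on $\mathbb R^p$; for all $\mathbf x\in\mathcal Z$ and all $\beta$, the functions $\phi(\mathbf x,\cdot,\beta)$ and $q(\cdot,\beta)$ are continuous on $\mathcal Z$; and $(\mathbf x,\mathbf y,\mathbf z)\mapsto p(\mathbf x,\mathbf y,\mathbf z)$ is continuous on $\mathcal Z^3$. Integrability: for $\varepsilon>0$ write $F_\varepsilon(x)=\sup_{|x-t|<\varepsilon}|F(t)|$, the arguments $t$ that stand for values of $\mathbf Z$ in $\phi,A,\dots,F$ below ranging over $\mathcal Z$. Let $A,B,C,D$ (at $(\mathbf x,\mathbf y,\mathbf z)$) and $E,F$ (at $(\mathbf x,\mathbf y)$)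 be the conditional expectations, given $\mathbf Z_1=\mathbf x,\mathbf Z_2=\mathbf y,\mathbf Z_3=\mathbf z$, respectively given $\mathbf Z_1=\mathbf x,\mathbf Z_2=\mathbf y$, of the product of $\ell_\beta(W_{(1,2)},\mathbf Z_1)$ with, respectively, $\ell_\beta(W_{(1,3)},\mathbf Z_1)$, $\ell_\beta(W_{(3,1)},\mathbf Z_3)$, $\ell_\beta(W_{(3,2)},\mathbf Z_3)$, $\ell_\beta(W_{(2,3)},\mathbf Z_2)$, and $\ell_\beta(W_{(1,2)},\mathbf Z_1)$, $\ell_\beta(W_{(2,1)},\mathbf Z_2)$. Assume that for every $\beta$ there is $\varepsilon>0$ with $$\int\big(A(\mathbf z,\cdot,\cdot)_\varepsilon(\mathbf z,\mathbf z)+B(\mathbf z,\cdot,\cdot)_\varepsilon(\mathbf z,\mathbf z)+C(\cdot,\mathbf z,\cdot)_\varepsilon(\mathbf z,\mathbf z)+D(\cdot,\mathbf z,\cdot)_\varepsilon(\mathbf z,\mathbf z)\big)f_{\mathbf Z,\varepsilon}^2(\mathbf z)f_{\mathbf Z}(\mathbf z)\,d\mathbf z<\infty,$$ $$\int\big(\phi(\mathbf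 z,\cdot,\beta)_\varepsilon(\mathbf z)+E(\mathbf z,\cdot)_\varepsilon(\mathbf z)+F(\mathbf z,\cdot)_\varepsilon(\mathbf z)\big)f_{\mathbf Z,\varepsilon}(\mathbf z)f_{\mathbf Z}(\mathbf z)\,d\mathbf z<\infty.$$ Assume moreover that $\beta\mapsto L_n(\beta)$ is almost surely concave for every $n$, that $\lambda_n\to\lambda_\infty$ and $n^2h_n^p\to\infty$, and that $\beta\mapsto L_\infty(\beta)-\lambda_\infty|\beta|_1$ has a unique maximizer $\beta^{**}$, where $L_\infty(\beta)=\int\phi(\mathbf z,\mathbf z,\beta)f_{\mathbf Z}(\mathbf z)^2\,d\mathbf z$. Then the integral defining $L_\infty(\beta)$ converges absolutely for every $\beta$, and $\hat\beta_n\to\beta^{**}$ in probability. If $\lambda_\infty=0$, then $\beta^{**}=\beta^*$. -/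

import Mathlib

open MeasureTheory ProbabilityTheory Filter Topology
open scoped ENNReal

noncomputable section

namespace CKT

/-- `ℝ^d` with its Euclidean norm and Lebesgue measure. -/
abbrev Vec (d : ℕ) : Type := EuclideanSpace ℝ (Fin d)

/-- The `ℓ¹` norm on `ℝ^d`. -/
def l1 {d : ℕ} (b : Vec d) : ℝ := ∑ k, |b k|

/-- `K` is a compactly supported (square integrable) kernel on `ℝ^p` of order `m`: it integrates to
one and all its moments of total degree `1, …, m - 1` vanish. -/
structure IsKernelOfOrder {p : ℕ} (K : Vec p → ℝ) (m : ℕ) : Prop where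
  measurable : Measurable K
  compactSupport : HasCompactSupport K
  sq_integrable : Integrable (fun t => K t ^ 2)
  integral_eq_one : ∫ t, K t = 1
  moments : ∀ a : Fin p → ℕ, 1 ≤ ∑ i, a i → ∑ i, a i < m →
    ∫ t, (∏ i, t i ^ a i) * K t = 0

/-- The rescaled kernel `K_h(z) = K(z/h)/h^p`. -/
def scaled {p : ℕ} (K : Vec p → ℝ) (h : ℝ) (z : Vec p) : ℝ := K (h⁻¹ • z) / h ^ p

/-- The pair of observations `x, y` of the bivariate variable is concordant. -/
def Concordant (x y : ℝ × ℝ) : Prop := 0 < (y.1 - x.1) * (y.2 - x.2)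

/-- The pair of observations `x, y` of the bivariate variable is strictly discordant. -/
def Discordant (x y : ℝ × ℝ) : Prop := (y.1 - x.1) * (y.2 - x.2) < 0

open Classical in
/-- The sign `W = 2 · 1{concordant} - 1` of a pair. -/
def W (x y : ℝ × ℝ) : ℝ := 2 * (if Concordant x y then 1 else 0) - 1

section CondLaw

variable {p d : ℕ}

/-! In this section `κ z` is the conditional law of the bivariate variable `X` given `Z = z`, so that,
for independent copies, the conditional law of `(X₁, X₂)` given `Z₁ = x, Z₂ = y` is `κ x ⊗ κ y`, and
similarly for three copies. -/

/-- `E[F(X₁, X₂) | Z₁ = x, Z₂ = y]`. -/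
def condE2 (κ : Kernel (Vec p) (ℝ × ℝ)) (x y : Vec p) (F : ℝ × ℝ → ℝ × ℝ → ℝ) : ℝ :=
  ∫ u, F u.1 u.2 ∂((κ x).prod (κ y))

/-- `E[F(X₁, X₂, X₃) | Z₁ = x, Z₂ = y, Z₃ = z]`. -/
def condE3 (κ : Kernel (Vec p) (ℝ × ℝ)) (x y z : Vec p)
    (F : ℝ × ℝ → ℝ × ℝ → ℝ × ℝ → ℝ) : ℝ :=
  ∫ u, F u.1 u.2.1 u.2.2 ∂((κ x).prod ((κ y).prod (κ z)))

/-- Conditional Kendall's tau given `Z = z`. -/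
def condTau (κ : Kernel (Vec p) (ℝ × ℝ)) (z : Vec p) : ℝ :=
  ((κ z).prod (κ z)).real {u | Concordant u.1 u.2} -
    ((κ z).prod (κ z)).real {u | Discordant u.1 u.2}

/-- `p(x, y)`: probability that the first two observations are concordant, given
`Z₁ = x, Z₂ = y`. -/
def prob2 (κ : Kernel (Vec p) (ℝ × ℝ)) (x y : Vec p) : ℝ :=
  ((κ x).prod (κ y)).real {u | Concordant u.1 u.2}

/-- `p(x, y, z)`: probability that the pairs `(1, 2)` and `(1, 3)` are both concordant, given
`Z₁ = x, Z₂ = y, Z₃ = z`. -/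
def prob3 (κ : Kernel (Vec p) (ℝ × ℝ)) (x y z : Vec p) : ℝ :=
  ((κ x).prod ((κ y).prod (κ z))).real {u | Concordant u.1 u.2.1 ∧ Concordant u.1 u.2.2}

/-- `q(x, β) = 1/2 + g(ψ(x)ᵀβ)/2`: the model probability of concordance given `Z₁ = Z₂ = x`. -/
def q (g : ℝ → ℝ) (ψ : Vec p → Vec d) (x : Vec p) (b : Vec d) : ℝ :=
  1 / 2 + g (∑ k, ψ x k * b k) / 2

/-- The log-likelihood `ℓ_β(w, z)` of a sign `w ∈ {1, -1}`. -/
def logLik (g : ℝ → ℝ) (ψ : Vec p → Vec d) (b : Vec d) (w : ℝ) (z : Vec p) : ℝ :=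
  (1 + w) / 2 * Real.log (q g ψ z b) + (1 - w) / 2 * Real.log (1 - q g ψ z b)

/-- `φ(x, y, β) = p(x, y) log q(x, β) + (1 - p(x, y)) log (1 - q(x, β))`. -/
def phi (κ : Kernel (Vec p) (ℝ × ℝ)) (g : ℝ → ℝ) (ψ : Vec p → Vec d)
    (x y : Vec p) (b : Vec d) : ℝ :=
  prob2 κ x y * Real.log (q g ψ x b) + (1 - prob2 κ x y) * Real.log (1 - q g ψ x b)

/-! The conditional second moments of the pairwise log-likelihoods, one for each way in which two
ordered pairs of distinct indices can share one or two indices. -/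

/-- `E[ℓ_β(W₍₁,₂₎, Z₁) ℓ_β(W₍₁,₃₎, Z₁) | Z₁ = x, Z₂ = y, Z₃ = z]`. -/
def momA (κ : Kernel (Vec p) (ℝ × ℝ)) (g : ℝ → ℝ) (ψ : Vec p → Vec d) (b : Vec d)
    (x y z : Vec p) : ℝ :=
  condE3 κ x y z fun x₁ x₂ x₃ => logLik g ψ b (W x₁ x₂) x * logLik g ψ b (W x₁ x₃) x

/-- `E[ℓ_β(W₍₁,₂₎, Z₁) ℓ_β(W₍₃,₁₎, Z₃) | Z₁ = x, Z₂ = y, Z₃ = z]`. -/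
def momB (κ : Kernel (Vec p) (ℝ × ℝ)) (g : ℝ → ℝ) (ψ : Vec p → Vec d) (b : Vec d)
    (x y z : Vec p) : ℝ :=
  condE3 κ x y z fun x₁ x₂ x₃ => logLik g ψ b (W x₁ x₂) x * logLik g ψ b (W x₃ x₁) z

/-- `E[ℓ_β(W₍₁,₂₎, Z₁) ℓ_β(W₍₃,₂₎, Z₃) | Z₁ = x, Z₂ = y, Z₃ = z]`. -/
def momC (κ : Kernel (Vec p) (ℝ × ℝ)) (g : ℝ → ℝ) (ψ : Vec p → Vec d) (b : Vec d)
    (x y z : Vec p) : ℝ :=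
  condE3 κ x y z fun x₁ x₂ x₃ => logLik g ψ b (W x₁ x₂) x * logLik g ψ b (W x₃ x₂) z

/-- `E[ℓ_β(W₍₁,₂₎, Z₁) ℓ_β(W₍₂,₃₎, Z₂) | Z₁ = x, Z₂ = y, Z₃ = z]`. -/
def momD (κ : Kernel (Vec p) (ℝ × ℝ)) (g : ℝ → ℝ) (ψ : Vec p → Vec d) (b : Vec d)
    (x y z : Vec p) : ℝ :=
  condE3 κ x y z fun x₁ x₂ x₃ => logLik g ψ b (W x₁ x₂) x * logLik g ψ b (W x₂ x₃) y

/-- `E[ℓ_β(W₍₁,₂₎, Z₁)² | Z₁ = x, Z₂ = y]`. -/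
def momE (κ : Kernel (Vec p) (ℝ × ℝ)) (g : ℝ → ℝ) (ψ : Vec p → Vec d) (b : Vec d)
    (x y : Vec p) : ℝ :=
  condE2 κ x y fun x₁ x₂ => logLik g ψ b (W x₁ x₂) x ^ 2

/-- `E[ℓ_β(W₍₁,₂₎, Z₁) ℓ_β(W₍₂,₁₎, Z₂) | Z₁ = x, Z₂ = y]`. -/
def momF (κ : Kernel (Vec p) (ℝ × ℝ)) (g : ℝ → ℝ) (ψ : Vec p → Vec d) (b : Vec d)
    (x y : Vec p) : ℝ :=
  condE2 κ x y fun x₁ x₂ => logLik g ψ b (W x₁ x₂) x * logLik g ψ b (W x₂ x₁) y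

end CondLaw

/-- `F_ε(x) = sup {|F(t)| : t ∈ S, |x - t| < ε}`, for a function `F` of interest on `S`, with values
in `[0, ∞]`. -/
def locSup {α : Type*} [PseudoMetricSpace α] (S : Set α) (ε : ℝ) (F : α → ℝ) (x : α) : ℝ≥0∞ :=
  ⨆ t ∈ {t | t ∈ S ∧ dist x t < ε}, ENNReal.ofReal |F t|

section Assumptions

variable {p d : ℕ}

/-- Regularity: the density `f` of `Z` is `m` times continuously differentiable, `φ(x, ·, β)` and
`q(·, β)` are continuous on `S` for all `x ∈ S` and all `β`, and `p(·, ·, ·)` is continuous on `S³`. -/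
structure Regular (κ : Kernel (Vec p) (ℝ × ℝ)) (g : ℝ → ℝ) (ψ : Vec p → Vec d)
    (S : Set (Vec p)) (f : Vec p → ℝ) (m : ℕ) : Prop where
  density : ContDiff ℝ m f
  phi_continuous : ∀ x ∈ S, ∀ b : Vec d, ContinuousOn (fun y => phi κ g ψ x y b) S
  q_continuous : ∀ b : Vec d, ContinuousOn (fun x => q g ψ x b) S
  prob3_continuous : ContinuousOn
    (fun u : Vec p × Vec p × Vec p => prob3 κ u.1 u.2.1 u.2.2) (S ×ˢ S ×ˢ S)

/-- First integrability condition at `β`, with radius `ε`. -/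
def IntegrabilityOne (κ : Kernel (Vec p) (ℝ × ℝ)) (g : ℝ → ℝ) (ψ : Vec p → Vec d)
    (S : Set (Vec p)) (f : Vec p → ℝ) (b : Vec d) (ε : ℝ) : Prop :=
  ∫⁻ z, (locSup (S ×ˢ S) ε (fun s => momA κ g ψ b z s.1 s.2) (z, z)
      + locSup (S ×ˢ S) ε (fun s => momB κ g ψ b z s.1 s.2) (z, z)
      + locSup (S ×ˢ S) ε (fun s => momC κ g ψ b s.1 z s.2) (z, z)
      + locSup (S ×ˢ S) ε (fun s => momD κ g ψ b s.1 z s.2) (z, z))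
    * locSup Set.univ ε f z ^ 2 * ENNReal.ofReal (f z) < ∞

/-- Second integrability condition at `β`, with radius `ε`. -/
def IntegrabilityTwo (κ : Kernel (Vec p) (ℝ × ℝ)) (g : ℝ → ℝ) (ψ : Vec p → Vec d)
    (S : Set (Vec p)) (f : Vec p → ℝ) (b : Vec d) (ε : ℝ) : Prop :=
  ∫⁻ z, (locSup S ε (fun y => phi κ g ψ z y b) z
      + locSup S ε (fun y => momE κ g ψ b z y) z
      + locSup S ε (fun y => momF κ g ψ b z y) z)
    * locSup Set.univ ε f z * ENNReal.ofReal (f z) < ∞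

end Assumptions

section Criterion

variable {p d : ℕ}

/-- The localized log-likelihood `L_n(β)` computed from the first `n` of the observations `(z i, x i)`,
with bandwidth `h`. -/
def Ln (K : Vec p → ℝ) (g : ℝ → ℝ) (ψ : Vec p → Vec d) (n : ℕ) (h : ℝ)
    (z : ℕ → Vec p) (x : ℕ → ℝ × ℝ) (b : Vec d) : ℝ :=
  1 / ((n : ℝ) * ((n : ℝ) - 1)) *
    ∑ i ∈ Finset.range n, ∑ j ∈ (Finset.range n).filter (fun j => i ≠ j),
      scaled K h (z i - z j) * logLik g ψ b (W (x i) (x j)) (z i)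

/-- `L_∞(β) = ∫ φ(z, z, β) f(z)² dz`. -/
def Linf (κ : Kernel (Vec p) (ℝ × ℝ)) (g : ℝ → ℝ) (ψ : Vec p → Vec d) (f : Vec p → ℝ)
    (b : Vec d) : ℝ :=
  ∫ z, phi κ g ψ z z b * f z ^ 2

/-- `b` maximizes `F`. -/
def IsArgmax (F : Vec d → ℝ) (b : Vec d) : Prop := ∀ b', F b' ≤ F b

/-- `b` is the unique maximizer of `F`. -/
def IsUniqueArgmax (F : Vec d → ℝ) (b : Vec d) : Prop := ∀ b', b' ≠ b → F b' < F b

end Criterion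

end CKT

end

/-!
Pointwise limits of concave criteria converge locally uniformly, so if the limit has a unique
maximizer then the maximizers of the criteria converge to it; hence it is enough to show
`L_n(β) → L_∞(β)` in probability for each fixed `β`.

`L_n(β)` is a U-statistic of order two with kernel `K_h(z₁ - z₂) ℓ_β`. For a bounded loss that
vanishes outside of a ball, this kernel has conditional `L¹` norms bounded uniformly in `h` and a
second moment of order `h⁻ᵖ`, so the variance is of order `1 / n + 1 / (n² hᵖ)` and vanishes, while
the mean converges because `K_h` is an approximate identity and `f` and `φ` are continuous. A
general loss is truncated: as `ℓ_β ≤ 0`, the `L¹` norm of the remainder is at most an integral of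
`|K_h| |φ|` over the truncated region, which is small uniformly in `n` by the integrable envelope
`φ_ε f_ε f`.

Since the conditional laws of `X` have no ties, `τ = 2 p(z, z) - 1`, so in the single-index model
`p(z, z) = q(z, β*)`. Gibbs' inequality for Bernoulli laws then shows that `β*` maximizes
`φ(z, z, ·)` for every `z`, hence also `L_∞`.
-/

namespace CKT

section Concave

/-- The set of concave functions on `V`. As a subset of `V → ℝ` it carries the topology of
pointwise convergence, for which the limit of the criteria is taken. -/
def concaveFunctions (V : Type*) [AddCommGroup V] [Module ℝ V] : Set (V → ℝ) :=
  {m | ConcaveOn ℝ Set.univ m}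

variable {V : Type*}

lemma isClosed_concaveFunctions [AddCommGroup V] [Module ℝ V] :
    IsClosed (concaveFunctions V) := by
  have heq : concaveFunctions V = ⋂ (x : V) (y : V) (a : ℝ) (b : ℝ) (_ : 0 ≤ a) (_ : 0 ≤ b)
      (_ : a + b = 1), {m : V → ℝ | a • m x + b • m y ≤ m (a • x + b • y)} := by
    ext m
    simp only [concaveFunctions, Set.mem_ofPred_eq, Set.mem_iInter]
    exact ⟨fun hm x y a b ha hb hab => hm.2 (Set.mem_univ _) (Set.mem_univ _) ha hb hab,
      fun hm => ⟨convex_univ, fun x _ y _ a b ha hb hab => hm x y a b ha hb hab⟩⟩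
  rw [heq]
  refine isClosed_iInter fun x => isClosed_iInter fun y => isClosed_iInter fun a =>
    isClosed_iInter fun b => isClosed_iInter fun _ => isClosed_iInter fun _ =>
    isClosed_iInter fun _ => isClosed_le ?_ ?_ <;> fun_prop

lemma concaveOn_add_reflection_le [AddCommGroup V] [Module ℝ V] {m : V → ℝ}
    (hm : ConcaveOn ℝ Set.univ m) (s x : V) : m x + m ((2 : ℝ) • s - x) ≤ 2 * m s := by
  have hmid := hm.2 (Set.mem_univ x) (Set.mem_univ ((2 : ℝ) • s - x))
    (by norm_num : (0 : ℝ) ≤ 1 / 2) (by norm_num : (0 : ℝ) ≤ 1 / 2) (by norm_num)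
  rw [show (1 / 2 : ℝ) • x + (1 / 2 : ℝ) • ((2 : ℝ) • s - x) = s by module, smul_eq_mul,
    smul_eq_mul] at hmid
  linarith

variable [NormedAddCommGroup V] [NormedSpace ℝ V]

lemma concaveOn_lt_of_forall_sphere_lt {m : V → ℝ} (hm : ConcaveOn ℝ Set.univ m) {c : V} {r : ℝ}
    (hr : 0 < r) (hs : ∀ s ∈ Metric.sphere c r, m s < m c) {x : V} (hx : r ≤ dist x c) :
    m x < m c := by
  have hd : 0 < dist x c := hr.trans_le hx
  by_contra! hle
  set a : ℝ := r / dist x c with ha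
  have ha0 : 0 ≤ a := by positivity
  have ha1 : a ≤ 1 := by rw [ha, div_le_one hd]; exact hx
  have hmem : (1 - a) • c + a • x ∈ Metric.sphere c r := by
    have hsub : (1 - a) • c + a • x - c = a • (x - c) := by module
    rw [mem_sphere_iff_norm, hsub, norm_smul, Real.norm_of_nonneg ha0, ← dist_eq_norm, ha]
    field_simp
  have hconc := hm.2 (Set.mem_univ c) (Set.mem_univ x) (sub_nonneg.2 ha1) ha0 (by ring)
  simp only [smul_eq_mul] at hconc
  nlinarith [hs _ hmem]

variable [FiniteDimensional ℝ V]

lemma exists_forall_le_of_forall_sphere_lt {m : V → ℝ} (hm : ConcaveOn ℝ Set.univ m)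
    {c : V} {r : ℝ} (hr : 0 < r) (hs : ∀ s ∈ Metric.sphere c r, m s < m c) :
    ∃ b, ∀ x, m x ≤ m b := by
  obtain ⟨b, -, hb⟩ := (isCompact_closedBall c r).exists_isMaxOn
    ⟨c, Metric.mem_closedBall_self hr.le⟩ hm.locallyLipschitz.continuous.continuousOn
  refine ⟨b, fun x => ?_⟩
  rcases le_or_gt (dist x c) r with hx | hx
  · exact hb hx
  · exact (concaveOn_lt_of_forall_sphere_lt hm hr hs hx.le).le.trans
      (hb (Metric.mem_closedBall_self hr.le))

-- A concave `m` is bounded below near `s` by its values at the vertices of a small simplex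
-- around `s`; reflecting in `s` turns this into an upper bound.
lemma eventually_concaveFunctions_lt {M : V → ℝ} (hM : ConcaveOn ℝ Set.univ M) {s : V} {a : ℝ}
    (ha : M s < a) : ∀ᶠ z in 𝓝[concaveFunctions V] M ×ˢ 𝓝 s, z.1 z.2 < a := by
  obtain ⟨η, hη, hη4⟩ : ∃ η > 0, M s + 4 * η = a := ⟨(a - M s) / 4, by linarith, by ring⟩
  have hU : {x | M s - η < M x} ∈ 𝓝 s :=
    hM.locallyLipschitz.continuous.continuousAt.eventually (lt_mem_nhds (by linarith))
  obtain ⟨B, hB, hBs⟩ := exists_mem_interior_convexHull_affineBasis hU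
  have hvert : ∀ᶠ m in 𝓝 M, ∀ i, M s - 2 * η < m (B i) := by
    refine eventually_all.2 fun i => (continuous_apply (B i)).continuousAt.eventually
      (lt_mem_nhds ?_)
    have hMi : M s - η < M (B i) := hBs (subset_convexHull ℝ _ (Set.mem_range_self i))
    linarith
  have hs : ∀ᶠ m in 𝓝 M, m s < M s + η :=
    (continuous_apply s).continuousAt.eventually (gt_mem_nhds (by linarith))
  have hrefl : ∀ᶠ x in 𝓝 s, (2 : ℝ) • s - x ∈ convexHull ℝ (Set.range B) := by
    have hlim : Tendsto (fun x => (2 : ℝ) • s - x) (𝓝 s) (𝓝 ((2 : ℝ) • s - s)) :=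
      (continuous_const.sub continuous_id).continuousAt
    rw [show (2 : ℝ) • s - s = s by module] at hlim
    exact hlim.eventually (mem_interior_iff_mem_nhds.1 hB)
  have hfst : ∀ᶠ m in 𝓝[concaveFunctions V] M,
      m ∈ concaveFunctions V ∧ (∀ i, M s - 2 * η < m (B i)) ∧ m s < M s + η :=
    eventually_mem_nhdsWithin.and (nhdsWithin_le_nhds (hvert.and hs))
  filter_upwards [hfst.prod_mk hrefl] with ⟨m, x⟩ ⟨⟨hm, hmB, hms⟩, hx⟩
  obtain ⟨-, ⟨i, rfl⟩, hi⟩ := (hm.subset (Set.subset_univ _)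
    (convex_convexHull ℝ _)).exists_le_of_mem_convexHull (subset_convexHull ℝ _) hx
  have hmid : m x + m ((2 : ℝ) • s - x) ≤ 2 * m s := concaveOn_add_reflection_le hm s x
  have hmBi := hmB i
  dsimp only at hms hi ⊢
  linarith

lemma eventually_forall_sphere_lt {M : V → ℝ} (hM : ConcaveOn ℝ Set.univ M) {c : V}
    {r : ℝ} (hc : ∀ s ∈ Metric.sphere c r, M s < M c) :
    ∀ᶠ m in 𝓝[concaveFunctions V] M, ∀ s ∈ Metric.sphere c r, m s < m c := by
  have hloc : ∀ s ∈ Metric.sphere c r,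
      ∀ᶠ z in 𝓝[concaveFunctions V] M ×ˢ 𝓝 s, z.1 z.2 < z.1 c := by
    intro s hs
    obtain ⟨a, hsa, hac⟩ := exists_between (hc s hs)
    have hm : ∀ᶠ m in 𝓝[concaveFunctions V] M, a < m c :=
      nhdsWithin_le_nhds ((continuous_apply c).continuousAt.eventually (lt_mem_nhds hac))
    filter_upwards [eventually_concaveFunctions_lt hM hsa, hm.prod_inl (𝓝 s)] with z hz hzc
    exact hz.trans hzc
  have hunif : ∀ᶠ z in 𝓝[concaveFunctions V] M ×ˢ 𝓟 (Metric.sphere c r), z.1 z.2 < z.1 c :=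
    prod_mono_right _ principal_le_nhdsSet ((isCompact_sphere c r).mem_prod_nhdsSet_of_forall hloc)
  exact eventually_prod_principal_iff.1 hunif

lemma eventually_concaveFunctions_argmax {M : V → ℝ} (hM : ConcaveOn ℝ Set.univ M) {c : V}
    (hc : ∀ x, x ≠ c → M x < M c) {r : ℝ} (hr : 0 < r) :
    ∀ᶠ m in 𝓝[concaveFunctions V] M,
      (∃ b, ∀ x, m x ≤ m b) ∧ ∀ b, (∀ x, m x ≤ m b) → dist b c < r := by
  have hsphere := eventually_forall_sphere_lt hM
    fun s hs => hc s (Metric.ne_of_mem_sphere hs hr.ne')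
  filter_upwards [hsphere, eventually_mem_nhdsWithin] with m hm hconc
  refine ⟨exists_forall_le_of_forall_sphere_lt hconc hr hm, fun b hb => ?_⟩
  by_contra! hle
  exact (concaveOn_lt_of_forall_sphere_lt hconc hr hm hle).not_ge (hb c)

end Concave

section Argmax

variable {Ω V : Type*} [MeasurableSpace Ω] {P : Measure Ω}

lemma tendsto_measure_notMem_of_tendstoInMeasure {M : ℕ → Ω → V → ℝ} {M₀ : V → ℝ}
    (h : ∀ x, TendstoInMeasure P (fun n ω => M n ω x) atTop (fun _ => M₀ x))
    {U : Set (V → ℝ)} (hU : U ∈ 𝓝 M₀) : Tendsto (fun n => P {ω | M n ω ∉ U}) atTop (𝓝 0) := by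
  rw [nhds_pi, Filter.mem_pi] at hU
  obtain ⟨I, hI, t, ht, htU⟩ := hU
  choose ε hε0 hεt using fun x => Metric.mem_nhds_iff.1 (ht x)
  have hlim : Tendsto (fun n => ∑ x ∈ hI.toFinset,
      P {ω | ENNReal.ofReal (ε x) ≤ edist (M n ω x) (M₀ x)}) atTop (𝓝 0) := by
    rw [← Finset.sum_const_zero (s := hI.toFinset)]
    exact tendsto_finsetSum _ fun x _ => h x _ (ENNReal.ofReal_pos.2 (hε0 x))
  refine tendsto_of_tendsto_of_tendsto_of_le_of_le tendsto_const_nhds hlim (fun _ => zero_le)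
    fun n => (measure_mono fun ω hω => ?_).trans (measure_biUnion_finset_le _ _)
  by_contra hclose
  refine hω (htU fun x hx => hεt x ?_)
  simp only [Set.mem_iUnion, Set.mem_ofPred_eq, not_exists, not_le] at hclose
  have hdist := hclose x (hI.mem_toFinset.2 hx)
  rw [edist_dist] at hdist
  exact (ENNReal.ofReal_lt_ofReal_iff (hε0 x)).1 hdist

lemma concaveOn_of_tendstoInMeasure [NeZero P] [AddCommGroup V] [Module ℝ V]
    {M : ℕ → Ω → V → ℝ} {M₀ : V → ℝ}
    (h : ∀ x, TendstoInMeasure P (fun n ω => M n ω x) atTop (fun _ => M₀ x))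
    (hM : ∀ n, ∀ᵐ ω ∂P, ConcaveOn ℝ Set.univ (M n ω)) : ConcaveOn ℝ Set.univ M₀ := by
  refine isClosed_concaveFunctions.closure_subset (mem_closure_iff_nhds.2 fun U hU => ?_)
  obtain ⟨n, hn⟩ := ((tendsto_measure_notMem_of_tendstoInMeasure h hU).eventually
    (gt_mem_nhds (Measure.measure_univ_pos.2 (NeZero.ne P)))).exists
  by_contra hempty
  have hae : ∀ᵐ ω ∂P, M n ω ∉ U := by
    filter_upwards [hM n] with ω hω hmem
    exact hempty ⟨M n ω, hmem, hω⟩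
  rw [measure_congr (t := Set.univ) (eventuallyEq_univ.2 hae)] at hn
  exact lt_irrefl _ hn

theorem tendstoInMeasure_argmax_of_concave [NeZero P] [NormedAddCommGroup V] [NormedSpace ℝ V]
    [FiniteDimensional ℝ V] {M : ℕ → Ω → V → ℝ} {M₀ : V → ℝ}
    (h : ∀ x, TendstoInMeasure P (fun n ω => M n ω x) atTop (fun _ => M₀ x))
    (hM : ∀ n, ∀ᵐ ω ∂P, ConcaveOn ℝ Set.univ (M n ω)) {b : ℕ → Ω → V}
    (hb : ∀ n, ∀ᵐ ω ∂P, (∃ b', ∀ x, M n ω x ≤ M n ω b') → ∀ x, M n ω x ≤ M n ω (b n ω))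
    {c : V} (hc : ∀ x, x ≠ c → M₀ x < M₀ c) :
    TendstoInMeasure P b atTop (fun _ => c) := by
  rw [tendstoInMeasure_iff_dist]
  intro r hr
  obtain ⟨U, hU, hUsub⟩ := mem_nhdsWithin_iff_exists_mem_nhds_inter.1
    (eventually_concaveFunctions_argmax (concaveOn_of_tendstoInMeasure h hM) hc hr)
  refine tendsto_of_tendsto_of_tendsto_of_le_of_le tendsto_const_nhds
    (tendsto_measure_notMem_of_tendstoInMeasure h hU) (fun _ => zero_le)
    fun n => measure_mono_ae ?_
  filter_upwards [hM n, hb n] with ω hconc hmax hfar hmem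
  obtain ⟨hex, hnear⟩ := hUsub ⟨hmem, hconc⟩
  exact (hnear _ (hmax hex)).not_ge hfar

end Argmax

section ConvergenceInMeasure

variable {Ω ι F : Type*} [MeasurableSpace Ω] {P : Measure Ω} {l : Filter ι}

lemma tendstoInMeasure_add_of_tendsto [SeminormedAddCommGroup F] {U : ι → Ω → F} {U₀ : Ω → F}
    (hU : TendstoInMeasure P U l U₀) {c : ι → F} {c₀ : F} (hc : Tendsto c l (𝓝 c₀)) :
    TendstoInMeasure P (fun n ω => U n ω + c n) l (fun ω => U₀ ω + c₀) := by
  rw [tendstoInMeasure_iff_dist] at hU ⊢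
  intro η hη
  refine tendsto_of_tendsto_of_tendsto_of_le_of_le' tendsto_const_nhds (hU (η / 2) (by positivity))
    (Eventually.of_forall fun _ => zero_le) ?_
  filter_upwards [Metric.tendsto_nhds.1 hc (η / 2) (by positivity)] with n hn
  refine measure_mono fun ω (hω : η ≤ dist (U n ω + c n) (U₀ ω + c₀)) => ?_
  have htri := dist_add_add_le (U n ω) (c n) (U₀ ω) c₀
  rw [Set.mem_ofPred_eq]
  linarith

lemma tendstoInMeasure_of_tendsto_variance [IsFiniteMeasure P] {U : ι → Ω → ℝ} {θ : ℝ}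
    (hU : ∀ᶠ n in l, MemLp (U n) 2 P) (hmean : Tendsto (fun n => ∫ ω, U n ω ∂P) l (𝓝 θ))
    (hvar : Tendsto (fun n => Var[U n; P]) l (𝓝 0)) :
    TendstoInMeasure P U l (fun _ => θ) := by
  have hcentred : TendstoInMeasure P (fun n ω => U n ω - ∫ ω, U n ω ∂P) l (fun _ => 0) := by
    rw [tendstoInMeasure_iff_dist]
    intro η hη
    have hlim : Tendsto (fun n => ENNReal.ofReal (Var[U n; P] / η ^ 2)) l (𝓝 0) := by
      simpa using ENNReal.tendsto_ofReal (hvar.div_const (η ^ 2))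
    refine tendsto_of_tendsto_of_tendsto_of_le_of_le' tendsto_const_nhds hlim
      (Eventually.of_forall fun _ => zero_le) ?_
    filter_upwards [hU] with n hn
    simpa only [Real.dist_eq, sub_zero] using meas_ge_le_variance_div_sq hn hη
  simpa using tendstoInMeasure_add_of_tendsto hcentred hmean

lemma measure_le_dist_le_lintegral_div [SeminormedAddCommGroup F] {U V : Ω → F}
    (hUV : AEStronglyMeasurable (U - V) P) {η : ℝ} (hη : 0 < η) :
    P {ω | η ≤ dist (U ω) (V ω)} ≤ (∫⁻ ω, ‖U ω - V ω‖ₑ ∂P) / ENNReal.ofReal η := by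
  have hset : {ω | η ≤ dist (U ω) (V ω)} = {ω | ENNReal.ofReal η ≤ ‖(U - V) ω‖ₑ} := by
    ext ω
    rw [Set.mem_ofPred_eq, Set.mem_ofPred_eq, Pi.sub_apply, ← ofReal_norm,
      ENNReal.ofReal_le_ofReal_iff (norm_nonneg _), dist_eq_norm]
  rw [hset]
  exact meas_ge_le_lintegral_div hUV.enorm (ENNReal.ofReal_pos.2 hη).ne' ENNReal.ofReal_ne_top

lemma tendstoInMeasure_of_forall_exists_approx [SeminormedAddCommGroup F] {U : ι → Ω → F} {θ : F}
    (h : ∀ δ > 0, ∃ (V : ι → Ω → F) (θ' : F), TendstoInMeasure P V l (fun _ => θ') ∧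
      dist θ' θ ≤ δ ∧ ∀ᶠ n in l, AEStronglyMeasurable (U n - V n) P ∧
        ∫⁻ ω, ‖U n ω - V n ω‖ₑ ∂P ≤ ENNReal.ofReal δ) :
    TendstoInMeasure P U l (fun _ => θ) := by
  rw [tendstoInMeasure_iff_dist]
  intro η hη
  rw [ENNReal.tendsto_nhds_zero]
  intro ρ hρ
  obtain ⟨δ, hδη, hδρ, hδ⟩ : ∃ δ : ℝ,
      δ < η / 3 ∧ ENNReal.ofReal δ / ENNReal.ofReal (η / 3) < ρ / 2 ∧ 0 < δ := by
    have hlim : Tendsto (fun δ : ℝ => ENNReal.ofReal δ / ENNReal.ofReal (η / 3)) (𝓝[>] 0)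
        (𝓝 0) := by
      have hη3 : ENNReal.ofReal (η / 3) ≠ 0 := (ENNReal.ofReal_pos.2 (by positivity)).ne'
      have hofReal : Tendsto ENNReal.ofReal (𝓝[>] 0) (𝓝 0) := by
        simpa using (ENNReal.continuous_ofReal.tendsto 0).mono_left nhdsWithin_le_nhds
      simpa using ENNReal.Tendsto.div_const hofReal (Or.inr hη3)
    have hsmall : ∀ᶠ δ : ℝ in 𝓝[>] 0, δ < η / 3 :=
      nhdsWithin_le_nhds (gt_mem_nhds (by positivity))
    exact (hsmall.and ((hlim.eventually (gt_mem_nhds (ENNReal.half_pos hρ.ne'))).and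
      self_mem_nhdsWithin)).exists
  obtain ⟨V, θ', hV, hθ, hUV⟩ := h δ hδ
  have hVρ := (ENNReal.tendsto_nhds_zero.1 (tendstoInMeasure_iff_dist.1 hV (η / 3)
    (by positivity))) (ρ / 2) (ENNReal.half_pos hρ.ne')
  filter_upwards [hVρ, hUV] with n hVn ⟨hmeas, hint⟩
  have hsub : {ω | η ≤ dist (U n ω) θ} ⊆
      {ω | η / 3 ≤ dist (U n ω) (V n ω)} ∪ {ω | η / 3 ≤ dist (V n ω) θ'} := by
    intro ω (hω : η ≤ dist (U n ω) θ)
    by_contra hsmall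
    simp only [Set.mem_union, Set.mem_ofPred_eq, not_or, not_le] at hsmall
    linarith [dist_triangle (U n ω) (V n ω) θ, dist_triangle (V n ω) θ' θ]
  calc P {ω | η ≤ dist (U n ω) θ}
      ≤ P {ω | η / 3 ≤ dist (U n ω) (V n ω)} + P {ω | η / 3 ≤ dist (V n ω) θ'} :=
        (measure_mono hsub).trans (measure_union_le _ _)
    _ ≤ ρ / 2 + ρ / 2 := by
        refine add_le_add ((measure_le_dist_le_lintegral_div hmeas (by positivity)).trans ?_) hVn
        exact (ENNReal.div_le_div_right hint _).trans hδρ.le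
    _ = ρ := ENNReal.add_halves ρ

end ConvergenceInMeasure

section UStatistic

open scoped NNReal

variable {Ω E : Type*}

/-- The U-statistic of order two with kernel `H` of the first `n` of the observations `y`: the mean
of `H` over the ordered pairs of distinct observations (and `0` if there is no such pair). -/
noncomputable def uStat (n : ℕ) (H : E × E → ℝ) (y : ℕ → E) : ℝ :=
  1 / ((n : ℝ) * ((n : ℝ) - 1)) * ∑ a ∈ (Finset.range n).offDiag, H (y a.1, y a.2)

lemma card_offDiag_range (n : ℕ) :
    ((Finset.range n).offDiag.card : ℝ) = (n : ℝ) * ((n : ℝ) - 1) := by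
  rw [Finset.offDiag_card, Finset.card_range, Nat.cast_sub (Nat.le_mul_self n)]
  push_cast
  ring

lemma uStat_sub (n : ℕ) (H H' : E × E → ℝ) (y : ℕ → E) :
    uStat n (H - H') y = uStat n H y - uStat n H' y := by
  simp only [uStat, Pi.sub_apply, Finset.sum_sub_distrib, mul_sub]

variable [MeasurableSpace Ω] [MeasurableSpace E] {P : Measure Ω} {μ : Measure E} {Y : ℕ → Ω → E}

/-- `Y` is a sequence of independent random variables with common law `μ` under `P`. -/
structure IsIIDSample (Y : ℕ → Ω → E) (μ : Measure E) (P : Measure Ω) : Prop where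
  measurable : ∀ i, Measurable (Y i)
  indep : iIndepFun Y P
  law : ∀ i, P.map (Y i) = μ

/-- Both families of sections of the kernel `H` are bounded by `C` in `L¹(μ)` (the hypothesis of
Schur's test). -/
structure HasSectionBound (H : E × E → ℝ) (μ : Measure E) (C : ℝ≥0) : Prop where
  left : ∀ y', ∫⁻ y, ‖H (y, y')‖ₑ ∂μ ≤ C
  right : ∀ y, ∫⁻ y', ‖H (y, y')‖ₑ ∂μ ≤ C

lemma memLp_two_of_lintegral_enorm_sq_le {α : Type*} [MeasurableSpace α] {ν : Measure α}
    {X : α → ℝ} (hX : AEStronglyMeasurable X ν) {D : ℝ≥0} (hD : ∫⁻ x, ‖X x‖ₑ ^ 2 ∂ν ≤ D) :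
    MemLp X 2 ν := by
  refine ⟨hX, ?_⟩
  rw [eLpNorm_lt_top_iff_lintegral_rpow_enorm_lt_top two_ne_zero ENNReal.ofNat_ne_top]
  simpa using hD.trans_lt ENNReal.coe_lt_top

lemma card_filter_offDiag_range_le (n i j : ℕ) :
    ((Finset.range n).offDiag.filter fun b => b.1 = i ∨ b.1 = j ∨ b.2 = i ∨ b.2 = j).card ≤
      4 * n := by
  calc _ ≤ (({i, j} : Finset ℕ) ×ˢ Finset.range n ∪ Finset.range n ×ˢ {i, j}).card := by
        refine Finset.card_le_card fun b hb => ?_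
        simp only [Finset.mem_filter, Finset.mem_offDiag, Finset.mem_union, Finset.mem_product,
          Finset.mem_insert, Finset.mem_singleton] at hb ⊢
        tauto
    _ ≤ 2 * n + n * 2 := by
        refine (Finset.card_union_le _ _).trans ?_
        rw [Finset.card_product, Finset.card_product, Finset.card_range]
        gcongr <;> exact Finset.card_le_two
    _ = 4 * n := by ring

namespace IsIIDSample

variable (hY : IsIIDSample Y μ P)
include hY

lemma measurable_pair (a : ℕ × ℕ) : Measurable fun ω => (Y a.1 ω, Y a.2 ω) :=
  (hY.measurable a.1).prodMk (hY.measurable a.2)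

lemma isProbabilityMeasure : IsProbabilityMeasure P := hY.indep.isProbabilityMeasure

lemma isProbabilityMeasure_law : IsProbabilityMeasure μ := by
  have := hY.isProbabilityMeasure
  exact hY.law 0 ▸ Measure.isProbabilityMeasure_map (hY.measurable 0).aemeasurable

lemma measurePreserving_pair {a : ℕ × ℕ} (ha : a.1 ≠ a.2) :
    MeasurePreserving (fun ω => (Y a.1 ω, Y a.2 ω)) P (μ.prod μ) := by
  have := hY.isProbabilityMeasure
  refine ⟨hY.measurable_pair a, ?_⟩
  rw [(indepFun_iff_map_prod_eq_prod_map_map (hY.measurable a.1).aemeasurable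
    (hY.measurable a.2).aemeasurable).1 (hY.indep.indepFun ha), hY.law, hY.law]

lemma integral_pair {H : E × E → ℝ} (hH : AEStronglyMeasurable H (μ.prod μ)) {a : ℕ × ℕ}
    (ha : a.1 ≠ a.2) : ∫ ω, H (Y a.1 ω, Y a.2 ω) ∂P = ∫ u, H u ∂(μ.prod μ) := by
  have hpair := hY.measurePreserving_pair ha
  rw [← hpair.map_eq] at hH ⊢
  exact (integral_map (hY.measurable_pair a).aemeasurable hH).symm

lemma memLp_pair {H : E × E → ℝ} {r : ℝ≥0∞} (hH : MemLp H r (μ.prod μ)) {a : ℕ × ℕ}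
    (ha : a.1 ≠ a.2) : MemLp (fun ω => H (Y a.1 ω, Y a.2 ω)) r P :=
  hH.comp_measurePreserving (hY.measurePreserving_pair ha)

lemma measurable_uStat {H : E × E → ℝ} (hH : Measurable H) (n : ℕ) :
    Measurable fun ω => uStat n H (fun i => Y i ω) :=
  (Finset.measurable_sum _ fun a _ => hH.comp (hY.measurable_pair a)).const_mul _

lemma lintegral_enorm_uStat_le {H : E × E → ℝ} (hH : Measurable H) (n : ℕ) :
    ∫⁻ ω, ‖uStat n H (fun i => Y i ω)‖ₑ ∂P ≤ ∫⁻ u, ‖H u‖ₑ ∂(μ.prod μ) := by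
  set c : ℝ := 1 / ((n : ℝ) * ((n : ℝ) - 1)) with hc
  calc ∫⁻ ω, ‖uStat n H (fun i => Y i ω)‖ₑ ∂P
      ≤ ∫⁻ ω, ‖c‖ₑ * ∑ a ∈ (Finset.range n).offDiag, ‖H (Y a.1 ω, Y a.2 ω)‖ₑ ∂P := by
        refine lintegral_mono fun ω => ?_
        rw [uStat, enorm_mul]
        gcongr
        exact enorm_sum_le _ _
    _ = ‖c‖ₑ * ∑ a ∈ (Finset.range n).offDiag, ∫⁻ ω, ‖H (Y a.1 ω, Y a.2 ω)‖ₑ ∂P := by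
        rw [lintegral_const_mul' _ _ enorm_ne_top, lintegral_finsetSum]
        exact fun a _ => hH.enorm.comp (hY.measurable_pair a)
    _ = ‖c‖ₑ * ((Finset.range n).offDiag.card • ∫⁻ u, ‖H u‖ₑ ∂(μ.prod μ)) := by
        rw [Finset.sum_congr rfl fun a ha =>
          (hY.measurePreserving_pair (Finset.mem_offDiag.1 ha).2.2).lintegral_comp hH.enorm,
          Finset.sum_const]
    _ = ‖c * ((n : ℝ) * ((n : ℝ) - 1))‖ₑ * ∫⁻ u, ‖H u‖ₑ ∂(μ.prod μ) := by
        rw [nsmul_eq_mul, ← mul_assoc, enorm_mul, ← card_offDiag_range, Real.enorm_natCast]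
    _ ≤ 1 * ∫⁻ u, ‖H u‖ₑ ∂(μ.prod μ) := by
        gcongr
        rw [hc, one_div_mul_eq_div]
        rcases eq_or_ne ((n : ℝ) * ((n : ℝ) - 1)) 0 with h0 | h0
        · simp [h0]
        · simp [div_self h0]
    _ = ∫⁻ u, ‖H u‖ₑ ∂(μ.prod μ) := one_mul _

lemma memLp_uStat {H : E × E → ℝ} {r : ℝ≥0∞} (hH : MemLp H r (μ.prod μ)) (n : ℕ) :
    MemLp (fun ω => uStat n H (fun i => Y i ω)) r P :=
  (memLp_finsetSum _ fun _ ha => hY.memLp_pair hH (Finset.mem_offDiag.1 ha).2.2).const_mul _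

lemma integral_uStat {H : E × E → ℝ} (hH : Integrable H (μ.prod μ)) {n : ℕ} (hn : 2 ≤ n) :
    ∫ ω, uStat n H (fun i => Y i ω) ∂P = ∫ u, H u ∂(μ.prod μ) := by
  have hn2 : (2 : ℝ) ≤ n := by exact_mod_cast hn
  have hpos : (n : ℝ) * ((n : ℝ) - 1) ≠ 0 := by nlinarith
  have hterm : ∀ a ∈ (Finset.range n).offDiag, Integrable (fun ω => H (Y a.1 ω, Y a.2 ω)) P :=
    fun _ ha => memLp_one_iff_integrable.1
      (hY.memLp_pair (memLp_one_iff_integrable.2 hH) (Finset.mem_offDiag.1 ha).2.2)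
  simp only [uStat]
  rw [integral_const_mul, integral_finsetSum _ hterm,
    Finset.sum_congr rfl fun a ha => hY.integral_pair hH.1 (Finset.mem_offDiag.1 ha).2.2,
    Finset.sum_const, nsmul_eq_mul, card_offDiag_range, ← mul_assoc, one_div_mul_cancel hpos,
    one_mul]

lemma indepFun_triple {i j k l : ℕ} (hji : j ≠ i) (hjk : j ≠ k) (hjl : j ≠ l) :
    IndepFun (fun ω => (Y i ω, Y k ω, Y l ω)) (Y j) P := by
  have hfin := hY.indep.indepFun_finset {i, k, l} {j} (by simp [hji, hjk, hjl]) hY.measurable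
  exact hfin.comp (φ := fun v : (({i, k, l} : Finset ℕ) → E) =>
      (v ⟨i, by simp⟩, v ⟨k, by simp⟩, v ⟨l, by simp⟩))
    (ψ := fun v : (({j} : Finset ℕ) → E) => v ⟨j, by simp⟩) (by fun_prop) (by fun_prop)

lemma lintegral_mul_le_of_section_le {G G' : E × E → ℝ≥0∞} (hG : Measurable G)
    (hG' : Measurable G') {C : ℝ≥0∞} (hC : ∀ y, ∫⁻ y', G (y, y') ∂μ ≤ C) {i j k l : ℕ}
    (hji : j ≠ i) (hjk : j ≠ k) (hjl : j ≠ l) :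
    ∫⁻ ω, G (Y i ω, Y j ω) * G' (Y k ω, Y l ω) ∂P ≤ C * ∫⁻ ω, G' (Y k ω, Y l ω) ∂P := by
  have := hY.isProbabilityMeasure
  have := hY.isProbabilityMeasure_law
  set T : Ω → E × E × E := fun ω => (Y i ω, Y k ω, Y l ω)
  have hTm : Measurable T :=
    (hY.measurable i).prodMk ((hY.measurable k).prodMk (hY.measurable l))
  have hmap := (indepFun_iff_map_prod_eq_prod_map_map hTm.aemeasurable
    (hY.measurable j).aemeasurable).1 (hY.indepFun_triple hji hjk hjl)
  have hF : Measurable fun u : (E × E × E) × E => G (u.1.1, u.2) * G' u.1.2 := by fun_prop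
  calc ∫⁻ ω, G (Y i ω, Y j ω) * G' (Y k ω, Y l ω) ∂P
      = ∫⁻ u, G (u.1.1, u.2) * G' u.1.2 ∂(P.map fun ω => (T ω, Y j ω)) := by
        rw [lintegral_map hF (hTm.prodMk (hY.measurable j))]
    _ = ∫⁻ t, ∫⁻ y, G (t.1, y) * G' t.2 ∂μ ∂(P.map T) := by
        rw [hmap, hY.law, lintegral_prod _ hF.aemeasurable]
    _ ≤ ∫⁻ t, C * G' t.2 ∂(P.map T) := by
        refine lintegral_mono fun t => ?_
        rw [lintegral_mul_const _ (by fun_prop)]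
        gcongr
        exact hC t.1
    _ = C * ∫⁻ ω, G' (Y k ω, Y l ω) ∂P := by
        rw [lintegral_const_mul _ (by fun_prop), lintegral_map (by fun_prop) hTm]

lemma lintegral_enorm_pair_le {H : E × E → ℝ} (hH : Measurable H) {C : ℝ≥0}
    (hC : HasSectionBound H μ C) {a : ℕ × ℕ} (ha : a.1 ≠ a.2) :
    ∫⁻ ω, ‖H (Y a.1 ω, Y a.2 ω)‖ₑ ∂P ≤ C := by
  have := hY.isProbabilityMeasure_law
  calc ∫⁻ ω, ‖H (Y a.1 ω, Y a.2 ω)‖ₑ ∂P = ∫⁻ y, ∫⁻ y', ‖H (y, y')‖ₑ ∂μ ∂μ := by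
        rw [← lintegral_prod _ hH.enorm.aemeasurable]
        exact (hY.measurePreserving_pair ha).lintegral_comp hH.enorm
    _ ≤ ∫⁻ _, C ∂μ := lintegral_mono hC.right
    _ = C := by simp

lemma lintegral_enorm_mul_pair_le_sq {H : E × E → ℝ} (hH : Measurable H) {C : ℝ≥0}
    (hC : HasSectionBound H μ C) {a b : ℕ × ℕ} (ha : a.1 ≠ a.2) (hb : b.1 ≠ b.2)
    (hab : (a.2 ≠ b.1 ∧ a.2 ≠ b.2) ∨ (a.1 ≠ b.1 ∧ a.1 ≠ b.2)) :
    ∫⁻ ω, ‖H (Y a.1 ω, Y a.2 ω)‖ₑ * ‖H (Y b.1 ω, Y b.2 ω)‖ₑ ∂P ≤ (C ^ 2 : ℝ≥0) := by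
  refine le_trans (b := C * ∫⁻ ω, ‖H (Y b.1 ω, Y b.2 ω)‖ₑ ∂P) ?_ ?_
  · rcases hab with ⟨hfst, hsnd⟩ | ⟨hfst, hsnd⟩
    · exact hY.lintegral_mul_le_of_section_le (G := fun u => ‖H u‖ₑ) hH.enorm hH.enorm hC.right
        ha.symm hfst hsnd
    · exact hY.lintegral_mul_le_of_section_le (G := fun u => ‖H u.swap‖ₑ)
        (hH.comp measurable_swap).enorm hH.enorm hC.left ha hfst hsnd
  · rw [pow_two, ENNReal.coe_mul]
    gcongr
    exact hY.lintegral_enorm_pair_le hH hC hb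

lemma lintegral_enorm_mul_pair_le {H : E × E → ℝ} (hH : Measurable H) {D : ℝ≥0}
    (hD : ∫⁻ u, ‖H u‖ₑ ^ 2 ∂(μ.prod μ) ≤ D) {a b : ℕ × ℕ} (ha : a.1 ≠ a.2) (hb : b.1 ≠ b.2) :
    ∫⁻ ω, ‖H (Y a.1 ω, Y a.2 ω)‖ₑ * ‖H (Y b.1 ω, Y b.2 ω)‖ₑ ∂P ≤ D := by
  have hsq : ∀ {c : ℕ × ℕ}, c.1 ≠ c.2 → ∫⁻ ω, ‖H (Y c.1 ω, Y c.2 ω)‖ₑ ^ 2 ∂P ≤ D := fun hc =>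
    ((hY.measurePreserving_pair hc).lintegral_comp (hH.enorm.pow_const 2)).trans_le hD
  have hmeas : ∀ c : ℕ × ℕ, Measurable fun ω => ‖H (Y c.1 ω, Y c.2 ω)‖ₑ ^ 2 := fun c =>
    (hH.enorm.pow_const 2).comp (hY.measurable_pair c)
  calc ∫⁻ ω, ‖H (Y a.1 ω, Y a.2 ω)‖ₑ * ‖H (Y b.1 ω, Y b.2 ω)‖ₑ ∂P
      ≤ ∫⁻ ω, (‖H (Y a.1 ω, Y a.2 ω)‖ₑ ^ 2 / 2 + ‖H (Y b.1 ω, Y b.2 ω)‖ₑ ^ 2 / 2) ∂P := by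
        refine lintegral_mono fun ω => ?_
        simpa using ENNReal.young_inequality ‖H (Y a.1 ω, Y a.2 ω)‖ₑ ‖H (Y b.1 ω, Y b.2 ω)‖ₑ
          Real.HolderConjugate.two_two
    _ = (∫⁻ ω, ‖H (Y a.1 ω, Y a.2 ω)‖ₑ ^ 2 ∂P) / 2 +
        (∫⁻ ω, ‖H (Y b.1 ω, Y b.2 ω)‖ₑ ^ 2 ∂P) / 2 := by
        simp only [div_eq_mul_inv]
        rw [lintegral_add_left ((hmeas a).mul_const _), lintegral_mul_const _ (hmeas a),
          lintegral_mul_const _ (hmeas b)]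
    _ ≤ D / 2 + D / 2 := by
        gcongr
        exacts [hsq ha, hsq hb]
    _ = D := ENNReal.add_halves _

lemma covariance_pair_le {H : E × E → ℝ} (hH : MemLp H 2 (μ.prod μ)) {a b : ℕ × ℕ}
    (ha : a.1 ≠ a.2) (hb : b.1 ≠ b.2) {B : ℝ≥0}
    (hB : ∫⁻ ω, ‖H (Y a.1 ω, Y a.2 ω)‖ₑ * ‖H (Y b.1 ω, Y b.2 ω)‖ₑ ∂P ≤ B) :
    cov[fun ω => H (Y a.1 ω, Y a.2 ω), fun ω => H (Y b.1 ω, Y b.2 ω); P] ≤ B := by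
  have := hY.isProbabilityMeasure
  have hprod : ∫ ω, H (Y a.1 ω, Y a.2 ω) * H (Y b.1 ω, Y b.2 ω) ∂P ≤ B := by
    refine (Real.le_norm_self _).trans ((norm_integral_le_lintegral_norm _).trans
      (ENNReal.toReal_le_coe_of_le_coe ?_))
    simpa only [norm_mul, ofReal_norm, ENNReal.ofReal_mul (norm_nonneg _)] using hB
  rw [covariance_eq_sub (hY.memLp_pair hH ha) (hY.memLp_pair hH hb), hY.integral_pair hH.1 ha,
    hY.integral_pair hH.1 hb]
  exact (sub_le_self _ (mul_self_nonneg _)).trans hprod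

lemma covariance_pair_le_ite {H : E × E → ℝ} (hH : Measurable H) {C D : ℝ≥0}
    (hC : HasSectionBound H μ C) (hD : ∫⁻ u, ‖H u‖ₑ ^ 2 ∂(μ.prod μ) ≤ D) {a b : ℕ × ℕ}
    (ha : a.1 ≠ a.2) (hb : b.1 ≠ b.2) :
    cov[fun ω => H (Y a.1 ω, Y a.2 ω), fun ω => H (Y b.1 ω, Y b.2 ω); P] ≤
      (if b.1 = a.1 ∨ b.1 = a.2 ∨ b.2 = a.1 ∨ b.2 = a.2 then (C : ℝ) ^ 2 else 0) +
        (if b = a ∨ b = a.swap then (D : ℝ) else 0) := by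
  have hH2 : MemLp H 2 (μ.prod μ) := memLp_two_of_lintegral_enorm_sq_le hH.aestronglyMeasurable hD
  have hC0 : (0 : ℝ) ≤ C ^ 2 := by positivity
  have hite {c : ℝ} (hc : 0 ≤ c) (q : Prop) [Decidable q] : 0 ≤ if q then c else 0 :=
    ite_nonneg hc le_rfl
  by_cases hdisj : (a.1 ≠ b.1 ∧ a.1 ≠ b.2) ∧ a.2 ≠ b.1 ∧ a.2 ≠ b.2
  · obtain ⟨⟨h11, h12⟩, h21, h22⟩ := hdisj
    have hcov := ((hY.indep.indepFun_prodMk_prodMk hY.measurable _ _ _ _ h11 h12 h21 h22).comp hH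
      hH).covariance_eq_zero (hY.memLp_pair hH2 ha) (hY.memLp_pair hH2 hb)
    exact hcov.trans_le (add_nonneg (hite hC0 _) (hite D.coe_nonneg _))
  by_cases hone : (a.2 ≠ b.1 ∧ a.2 ≠ b.2) ∨ (a.1 ≠ b.1 ∧ a.1 ≠ b.2)
  · have hcov := hY.covariance_pair_le hH2 ha hb
      (hY.lintegral_enorm_mul_pair_le_sq hH hC ha hb hone)
    rw [if_pos (by grind)]
    exact hcov.trans (by simpa using hite D.coe_nonneg _)
  · have hcov := hY.covariance_pair_le hH2 ha hb (hY.lintegral_enorm_mul_pair_le hH hD ha hb)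
    have hsame : b = a ∨ b = a.swap := by
      simp only [Prod.ext_iff, Prod.fst_swap, Prod.snd_swap]
      omega
    rw [if_pos hsame]
    exact hcov.trans (by simpa using hite hC0 _)

lemma variance_sum_offDiag_le {H : E × E → ℝ} (hH : Measurable H) {C D : ℝ≥0}
    (hC : HasSectionBound H μ C) (hD : ∫⁻ u, ‖H u‖ₑ ^ 2 ∂(μ.prod μ) ≤ D) (n : ℕ) :
    Var[fun ω => ∑ a ∈ (Finset.range n).offDiag, H (Y a.1 ω, Y a.2 ω); P] ≤
      (n : ℝ) ^ 2 * (4 * n * C ^ 2 + 2 * D) := by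
  have := hY.isProbabilityMeasure
  have hH2 : MemLp H 2 (μ.prod μ) := memLp_two_of_lintegral_enorm_sq_le hH.aestronglyMeasurable hD
  rw [variance_fun_sum' fun a ha => hY.memLp_pair hH2 (Finset.mem_offDiag.1 ha).2.2]
  have hrow : ∀ a ∈ (Finset.range n).offDiag, ∑ b ∈ (Finset.range n).offDiag,
      cov[fun ω => H (Y a.1 ω, Y a.2 ω), fun ω => H (Y b.1 ω, Y b.2 ω); P] ≤
      4 * n * C ^ 2 + 2 * D := by
    intro a ha
    refine (Finset.sum_le_sum fun b hb => hY.covariance_pair_le_ite hH hC hD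
      (Finset.mem_offDiag.1 ha).2.2 (Finset.mem_offDiag.1 hb).2.2).trans ?_
    rw [Finset.sum_add_distrib, ← Finset.sum_filter, ← Finset.sum_filter, Finset.sum_const,
      Finset.sum_const, nsmul_eq_mul, nsmul_eq_mul]
    gcongr
    · exact_mod_cast card_filter_offDiag_range_le n a.1 a.2
    · exact_mod_cast (Finset.card_le_card fun b hb => by
        simpa using (Finset.mem_filter.1 hb).2).trans (Finset.card_le_two (a := a) (b := a.swap))
  calc _ ≤ ∑ _a ∈ (Finset.range n).offDiag, (4 * n * (C : ℝ) ^ 2 + 2 * D) :=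
        Finset.sum_le_sum hrow
    _ = ((Finset.range n).offDiag.card : ℝ) * (4 * n * C ^ 2 + 2 * D) := by
        rw [Finset.sum_const, nsmul_eq_mul]
    _ ≤ (n : ℝ) ^ 2 * (4 * n * C ^ 2 + 2 * D) := by
        gcongr
        rw [card_offDiag_range]
        nlinarith [n.cast_nonneg (α := ℝ)]

lemma variance_uStat_le {H : E × E → ℝ} (hH : Measurable H) {C D : ℝ≥0}
    (hC : HasSectionBound H μ C) (hD : ∫⁻ u, ‖H u‖ₑ ^ 2 ∂(μ.prod μ) ≤ D) {n : ℕ} (hn : 2 ≤ n) :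
    Var[fun ω => uStat n H (fun i => Y i ω); P] ≤ 16 * C ^ 2 / n + 8 * (D / (n : ℝ) ^ 2) := by
  have hn2 : (2 : ℝ) ≤ n := by exact_mod_cast hn
  calc Var[fun ω => uStat n H (fun i => Y i ω); P]
      = (1 / ((n : ℝ) * ((n : ℝ) - 1))) ^ 2 *
          Var[fun ω => ∑ a ∈ (Finset.range n).offDiag, H (Y a.1 ω, Y a.2 ω); P] :=
        variance_const_mul _ _ _
    _ ≤ (1 / ((n : ℝ) * ((n : ℝ) / 2))) ^ 2 * ((n : ℝ) ^ 2 * (4 * n * C ^ 2 + 2 * D)) := by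
        gcongr
        · exact variance_nonneg _ _
        · exact one_div_nonneg.2 (by nlinarith)
        · linarith
        · exact hY.variance_sum_offDiag_le hH hC hD n
    _ = 16 * C ^ 2 / n + 8 * (D / (n : ℝ) ^ 2) := by
        field_simp
        ring

theorem tendstoInMeasure_uStat {H : ℕ → E × E → ℝ} (hH : ∀ n, Measurable (H n)) {C : ℝ≥0}
    (hC : ∀ᶠ n in atTop, HasSectionBound (H n) μ C) {D : ℕ → ℝ≥0}
    (hD : ∀ᶠ n in atTop, ∫⁻ u, ‖H n u‖ₑ ^ 2 ∂(μ.prod μ) ≤ D n)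
    (hDlim : Tendsto (fun n => (D n : ℝ) / (n : ℝ) ^ 2) atTop (𝓝 0)) {θ : ℝ}
    (hmean : Tendsto (fun n => ∫ u, H n u ∂(μ.prod μ)) atTop (𝓝 θ)) :
    TendstoInMeasure P (fun n ω => uStat n (H n) (fun i => Y i ω)) atTop (fun _ => θ) := by
  have := hY.isProbabilityMeasure
  have := hY.isProbabilityMeasure_law
  have hH2 : ∀ᶠ n in atTop, MemLp (H n) 2 (μ.prod μ) := hD.mono fun n hn =>
    memLp_two_of_lintegral_enorm_sq_le (hH n).aestronglyMeasurable hn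
  refine tendstoInMeasure_of_tendsto_variance (hH2.mono fun n hn => hY.memLp_uStat hn n) ?_ ?_
  · refine hmean.congr' ?_
    filter_upwards [hH2, eventually_ge_atTop 2] with n hn2 hn
    exact (hY.integral_uStat (hn2.integrable one_le_two) hn).symm
  · have hbound : Tendsto (fun n : ℕ => 16 * (C : ℝ) ^ 2 / n + 8 * (D n / (n : ℝ) ^ 2)) atTop
        (𝓝 0) := by
      simpa using (tendsto_const_div_atTop_nhds_zero_nat _).add (hDlim.const_mul 8)
    refine tendsto_of_tendsto_of_tendsto_of_le_of_le' tendsto_const_nhds hbound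
      (Eventually.of_forall fun _ => variance_nonneg _ _) ?_
    filter_upwards [hC, hD, eventually_ge_atTop 2] with n hCn hDn hn
    exact hY.variance_uStat_le (hH n) hCn hDn hn

end IsIIDSample

end UStatistic

section SmoothingKernel

variable {p : ℕ} {K : Vec p → ℝ} {h : ℝ}

lemma IsKernelOfOrder.integrable {m : ℕ} (hK : IsKernelOfOrder K m) : Integrable K :=
  Integrable.of_integral_ne_zero (by rw [hK.integral_eq_one]; exact one_ne_zero)

lemma IsKernelOfOrder.lintegral_enorm_sq_ne_top {m : ℕ} (hK : IsKernelOfOrder K m) :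
    ∫⁻ t, ‖K t‖ₑ ^ 2 ≠ ∞ := by
  simpa only [enorm_pow] using hK.sq_integrable.2.ne

lemma exists_norm_le_of_hasCompactSupport (hK : HasCompactSupport K) :
    ∃ R, ∀ t, K t ≠ 0 → ‖t‖ ≤ R := by
  obtain ⟨R, hR⟩ := hK.isCompact.isBounded.exists_norm_le
  exact ⟨R, fun t ht => hR t (subset_tsupport K ht)⟩

lemma measurable_scaled (hK : Measurable K) (h : ℝ) : Measurable (scaled K h) :=
  (hK.comp (measurable_const_smul h⁻¹)).div_const _

lemma norm_le_of_scaled_ne_zero {R : ℝ} (hR : ∀ t, K t ≠ 0 → ‖t‖ ≤ R) (hh : 0 < h) {z : Vec p}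
    (hz : scaled K h z ≠ 0) : ‖z‖ ≤ h * R := by
  have hK : K (h⁻¹ • z) ≠ 0 := fun h0 => hz (by simp [scaled, h0])
  simpa only [norm_smul, norm_inv, Real.norm_of_nonneg hh.le, inv_mul_le_iff₀ hh] using hR _ hK

lemma abs_scaled (hh : 0 < h) (z : Vec p) : |scaled K h z| = scaled (fun t => |K t|) h z := by
  rw [scaled, scaled, abs_div, abs_of_pos (pow_pos hh p)]

lemma enorm_scaled (hh : 0 < h) (z : Vec p) :
    ‖scaled K h z‖ₑ = ENNReal.ofReal (h ^ p)⁻¹ * ‖K (h⁻¹ • z)‖ₑ := by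
  rw [scaled, div_eq_inv_mul, enorm_mul, Real.enorm_of_nonneg (by positivity)]

lemma integrable_scaled (hK : Integrable K) (hh : 0 < h) : Integrable (scaled K h) :=
  (hK.comp_smul (inv_ne_zero hh.ne')).div_const _

lemma integral_scaled (hh : 0 < h) : ∫ z, scaled K h z = ∫ t, K t := by
  simp only [scaled]
  rw [integral_div, Measure.integral_comp_inv_smul_of_nonneg volume K hh.le,
    finrank_euclideanSpace_fin, smul_eq_mul, mul_div_cancel_left₀ _ (pow_pos hh p).ne']

lemma lintegral_comp_inv_smul (hh : 0 < h) {G : Vec p → ℝ≥0∞} (hG : Measurable G) :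
    ∫⁻ z, G (h⁻¹ • z) = ENNReal.ofReal (h ^ p) * ∫⁻ t, G t := by
  rw [← lintegral_map hG (measurable_const_smul h⁻¹),
    Measure.map_addHaar_smul volume (inv_ne_zero hh.ne'), lintegral_smul_measure,
    finrank_euclideanSpace_fin, inv_pow, inv_inv, abs_of_nonneg (by positivity), smul_eq_mul]

lemma lintegral_enorm_scaled_pow_succ (hK : Measurable K) (hh : 0 < h) (s : ℕ) :
    ∫⁻ z, ‖scaled K h z‖ₑ ^ (s + 1) = ENNReal.ofReal (h ^ p)⁻¹ ^ s * ∫⁻ t, ‖K t‖ₑ ^ (s + 1) := by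
  have hp : 0 < h ^ p := pow_pos hh p
  simp only [enorm_scaled hh, mul_pow]
  rw [lintegral_const_mul' _ _ (by finiteness),
    lintegral_comp_inv_smul hh (G := fun t => ‖K t‖ₑ ^ (s + 1)) (hK.enorm.pow_const _),
    ← mul_assoc, pow_succ, mul_assoc (_ ^ s), ← ENNReal.ofReal_mul (by positivity),
    inv_mul_cancel₀ hp.ne', ENNReal.ofReal_one, mul_one]

lemma lintegral_enorm_scaled (hK : Measurable K) (hh : 0 < h) :
    ∫⁻ z, ‖scaled K h z‖ₑ = ∫⁻ t, ‖K t‖ₑ := by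
  simpa only [zero_add, pow_one, pow_zero, one_mul] using lintegral_enorm_scaled_pow_succ hK hh 0

lemma eventually_mul_lt {ι : Type*} {l : Filter ι} {h : ι → ℝ} (hh : Tendsto h l (𝓝[>] 0)) (R : ℝ)
    {δ : ℝ} (hδ : 0 < δ) : ∀ᶠ n in l, h n * R < δ := by
  have hlim : Tendsto (fun n => h n * R) l (𝓝 0) := by
    simpa using (hh.mono_right nhdsWithin_le_nhds).mul_const R
  exact hlim.eventually (gt_mem_nhds hδ)

lemma abs_integral_scaled_mul_sub_le (hK : Integrable K) (hK1 : ∫ t, K t = 1) (hh : 0 < h)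
    {G : Vec p → ℝ} (hG : AEStronglyMeasurable G) {x : Vec p} {L η : ℝ}
    (hη : ∀ᵐ y, scaled K h (x - y) ≠ 0 → |G y - L| ≤ η) :
    |(∫ y, scaled K h (x - y) * G y) - L| ≤ (∫ t, |K t|) * η := by
  have hKx : Integrable fun y => scaled K h (x - y) := (integrable_scaled hK hh).comp_sub_left x
  have hdom : Integrable fun y => |scaled K h (x - y)| * η := hKx.abs.mul_const η
  have hbound : ∀ᵐ y, ‖scaled K h (x - y) * (G y - L)‖ ≤ |scaled K h (x - y)| * η := by
    filter_upwards [hη] with y hy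
    rw [Real.norm_eq_abs, abs_mul]
    rcases eq_or_ne (scaled K h (x - y)) 0 with h0 | h0
    · simp [h0]
    · exact mul_le_mul_of_nonneg_left (hy h0) (abs_nonneg _)
  have hdiff : Integrable fun y => scaled K h (x - y) * (G y - L) :=
    hdom.mono' (hKx.aestronglyMeasurable.mul (hG.sub aestronglyMeasurable_const)) hbound
  have hsub : (∫ y, scaled K h (x - y) * G y) - L = ∫ y, scaled K h (x - y) * (G y - L) := by
    have hsplit : ∀ y, scaled K h (x - y) * G y =
        scaled K h (x - y) * (G y - L) + scaled K h (x - y) * L := fun y => by ring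
    simp only [hsplit]
    rw [integral_add hdiff (hKx.mul_const L), integral_mul_const,
      integral_sub_left_eq_self (scaled K h), integral_scaled hh, hK1, one_mul,
      add_sub_cancel_right]
  calc |(∫ y, scaled K h (x - y) * G y) - L| ≤ ∫ y, |scaled K h (x - y)| * η :=
        hsub ▸ norm_integral_le_of_norm_le hdom hbound
    _ = (∫ t, |K t|) * η := by
        rw [integral_mul_const, integral_sub_left_eq_self (fun z => |scaled K h z|)]
        simp only [abs_scaled hh, integral_scaled hh]

lemma tendsto_integral_scaled_mul {ι : Type*} {l : Filter ι} {h : ι → ℝ}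
    (hh : Tendsto h l (𝓝[>] 0)) (hK : Integrable K) (hK1 : ∫ t, K t = 1)
    (hsupp : HasCompactSupport K) {G : Vec p → ℝ} (hG : AEStronglyMeasurable G) {T : Set (Vec p)}
    (hT : ∀ᵐ y, y ∈ T) {x : Vec p} {L : ℝ} (hL : Tendsto G (𝓝[T] x) (𝓝 L)) :
    Tendsto (fun n => ∫ y, scaled K (h n) (x - y) * G y) l (𝓝 L) := by
  obtain ⟨R, hR⟩ := exists_norm_le_of_hasCompactSupport hsupp
  have : 0 ≤ ∫ t, |K t| := integral_nonneg fun _ => abs_nonneg _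
  refine Metric.tendsto_nhds.2 fun ε hε => ?_
  obtain ⟨δ, hδ, hball⟩ := Metric.mem_nhdsWithin_iff.1
    (hL.eventually (Metric.ball_mem_nhds L (ε := ε / ((∫ t, |K t|) + 1)) (by positivity)))
  filter_upwards [eventually_mul_lt hh R hδ, hh.eventually self_mem_nhdsWithin] with n hnδ hn0
  refine (abs_integral_scaled_mul_sub_le (η := ε / ((∫ t, |K t|) + 1)) hK hK1 hn0 hG ?_).trans_lt ?_
  · filter_upwards [hT] with y hyT hy
    refine (Metric.mem_ball.1 (hball ⟨?_, hyT⟩)).le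
    rw [Metric.mem_ball', dist_eq_norm]
    exact (norm_le_of_scaled_ne_zero hR hn0 hy).trans_lt hnδ
  · rw [mul_div_assoc', div_lt_iff₀ (by positivity)]
    linarith [mul_comm ε (∫ t, |K t|)]

end SmoothingKernel

section PairLaw

variable {p : ℕ} {E : Type*}

/-- The measure with density `f` with respect to Lebesgue measure. -/
noncomputable abbrev densityMeasure (f : Vec p → ℝ) : Measure (Vec p) :=
  volume.withDensity fun z => ENNReal.ofReal (f z)

/-- The kernel of the localized U-statistic with smoothing kernel `K`, bandwidth `h` and loss `ℓ`:
the value at a pair `(z₁, x₁), (z₂, x₂)` is `K_h(z₁ - z₂) ℓ(z₁, x₁, x₂)`. -/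
noncomputable def pairKernel (K : Vec p → ℝ) (h : ℝ) (ℓ : Vec p → E × E → ℝ)
    (u : (Vec p × E) × (Vec p × E)) : ℝ :=
  scaled K h (u.1.1 - u.2.1) * ℓ u.1.1 (u.1.2, u.2.2)

variable {K : Vec p → ℝ} {h : ℝ} {ℓ : Vec p → E × E → ℝ}

lemma pairKernel_sub_indicator (T : Set (Vec p)) :
    pairKernel K h ℓ - pairKernel K h (T.indicator ℓ) = pairKernel K h (Tᶜ.indicator ℓ) := by
  funext u
  by_cases hu : u.1.1 ∈ T <;> simp [pairKernel, hu]

variable [MeasurableSpace E]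

lemma map_prod_compProd_eq {α : Type*} [MeasurableSpace α] (ν : Measure α) [SFinite ν]
    (κ : Kernel α E) [IsSFiniteKernel κ] :
    ((ν ⊗ₘ κ).prod (ν ⊗ₘ κ)).map (fun u => ((u.1.1, u.2.1), (u.1.2, u.2.2))) =
      (ν.prod ν) ⊗ₘ (κ ∥ₖ κ) := by
  refine Measure.ext_of_lintegral _ fun F hF => ?_
  rw [lintegral_map hF (by fun_prop), lintegral_prod _ (by fun_prop),
    Measure.lintegral_compProd (by fun_prop), Measure.lintegral_compProd hF,
    lintegral_prod _ hF.lintegral_kernel_prod_right'.aemeasurable]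
  refine lintegral_congr fun z => ?_
  have hinner : ∀ x : E, ∫⁻ y, F ((z, y.1), (x, y.2)) ∂(ν ⊗ₘ κ) =
      ∫⁻ z', ∫⁻ x', F ((z, z'), (x, x')) ∂κ z' ∂ν := fun x =>
    Measure.lintegral_compProd (by fun_prop)
  simp only [hinner]
  rw [lintegral_lintegral_swap]
  · refine lintegral_congr fun z' => ?_
    rw [Kernel.parallelComp_apply, lintegral_prod _ (by fun_prop)]
  · refine Measurable.aemeasurable ?_
    exact Measurable.lintegral_kernel_prod_right' (κ := κ.comap Prod.snd measurable_snd)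
      (f := fun v : (E × α) × E => F ((z, v.1.2), (v.1.1, v.2))) (by fun_prop)

/-- The conditional mean `E[ℓ(Z₁, X₁, X₂) | Z₁ = x, Z₂ = y]` of a loss `ℓ`. -/
noncomputable def condMean (κ : Kernel (Vec p) E) (ℓ : Vec p → E × E → ℝ) (x y : Vec p) : ℝ :=
  ∫ w, ℓ x w ∂((κ x).prod (κ y))

variable {κ : Kernel (Vec p) E}

lemma measurable_pairKernel (hK : Measurable K) (hℓ : Measurable (Function.uncurry ℓ)) (h : ℝ) :
    Measurable (pairKernel K h ℓ) := by
  have hs := measurable_scaled hK h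
  have hℓu := hℓ.comp (f := fun u : (Vec p × E) × (Vec p × E) => (u.1.1, (u.1.2, u.2.2)))
    (by fun_prop)
  exact Measurable.mul (by fun_prop) hℓu

lemma measurable_uncurry_indicator (hℓ : Measurable (Function.uncurry ℓ)) {T : Set (Vec p)}
    (hT : MeasurableSet T) : Measurable (Function.uncurry (T.indicator ℓ)) := by
  have hind : Function.uncurry (T.indicator ℓ) =
      (Prod.fst ⁻¹' T).indicator (Function.uncurry ℓ) := by
    funext v
    by_cases hv : v.1 ∈ T <;> simp [Function.uncurry_def, hv]
  exact hind ▸ hℓ.indicator (measurable_fst hT)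

lemma condMean_indicator (T : Set (Vec p)) :
    condMean κ (T.indicator ℓ) = T.indicator (condMean κ ℓ) := by
  funext x y
  by_cases hx : x ∈ T <;> simp [condMean, hx]

variable [IsMarkovKernel κ]

lemma measurable_condMean (hℓ : Measurable (Function.uncurry ℓ)) :
    Measurable fun v : Vec p × Vec p => condMean κ ℓ v.1 v.2 := by
  have hℓv := hℓ.comp (f := fun a : (Vec p × Vec p) × E × E => (a.1.1, a.2)) (by fun_prop)
  have hint := hℓv.stronglyMeasurable.integral_kernel_prod_right' (κ := κ ∥ₖ κ)
  simp only [Kernel.parallelComp_apply] at hint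
  exact hint.measurable

lemma abs_condMean_le {k : ℝ} {x : Vec p} (hℓ : ∀ w, |ℓ x w| ≤ k) (y : Vec p) :
    |condMean κ ℓ x y| ≤ k := by
  simpa [condMean] using norm_integral_le_of_norm_le_const (μ := (κ x).prod (κ y))
    (ae_of_all _ fun w => (Real.norm_eq_abs (ℓ x w)).trans_le (hℓ w))

lemma enorm_condMean_abs (hℓ : Measurable (Function.uncurry ℓ)) {x : Vec p} {k : ℝ}
    (hk : ∀ w, |ℓ x w| ≤ k) (y : Vec p) :
    ‖condMean κ (fun z w => |ℓ z w|) x y‖ₑ = ∫⁻ w, ‖ℓ x w‖ₑ ∂((κ x).prod (κ y)) := by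
  have hℓx : Measurable (ℓ x) := hℓ.comp (measurable_const.prodMk measurable_id)
  have hint : Integrable (ℓ x) ((κ x).prod (κ y)) :=
    Integrable.of_bound hℓx.aestronglyMeasurable k (ae_of_all _ hk)
  rw [condMean, Real.enorm_of_nonneg (integral_nonneg fun w => abs_nonneg _),
    ofReal_integral_eq_lintegral_ofReal hint.abs (ae_of_all _ fun w => abs_nonneg _)]
  simp only [Real.enorm_eq_ofReal_abs]

lemma lintegral_enorm_pairKernel (ν : Measure (Vec p)) [SFinite ν] (hK : Measurable K)
    (hℓ : Measurable (Function.uncurry ℓ)) {B : Vec p → ℝ} (hB : ∀ z w, |ℓ z w| ≤ B z) :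
    ∫⁻ u, ‖pairKernel K h ℓ u‖ₑ ∂((ν ⊗ₘ κ).prod (ν ⊗ₘ κ)) =
      ∫⁻ x, ∫⁻ y, ‖scaled K h (x - y)‖ₑ * ‖condMean κ (fun z w => |ℓ z w|) x y‖ₑ ∂ν ∂ν := by
  have hs := measurable_scaled hK h
  have hF : Measurable fun v : (Vec p × Vec p) × E × E =>
      ‖scaled K h (v.1.1 - v.1.2)‖ₑ * ‖ℓ v.1.1 v.2‖ₑ := by
    have hℓv := hℓ.comp (f := fun v : (Vec p × Vec p) × E × E => (v.1.1, v.2)) (by fun_prop)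
    exact Measurable.mul (by fun_prop) hℓv.enorm
  calc ∫⁻ u, ‖pairKernel K h ℓ u‖ₑ ∂((ν ⊗ₘ κ).prod (ν ⊗ₘ κ))
      = ∫⁻ v, ‖scaled K h (v.1.1 - v.1.2)‖ₑ * ‖ℓ v.1.1 v.2‖ₑ ∂((ν.prod ν) ⊗ₘ (κ ∥ₖ κ)) := by
        rw [← map_prod_compProd_eq, lintegral_map hF (by fun_prop)]
        simp only [pairKernel, enorm_mul]
    _ = ∫⁻ x, ∫⁻ y, ∫⁻ w, ‖scaled K h (x - y)‖ₑ * ‖ℓ x w‖ₑ ∂((κ x).prod (κ y)) ∂ν ∂ν := by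
        rw [Measure.lintegral_compProd hF,
          lintegral_prod _ hF.lintegral_kernel_prod_right'.aemeasurable]
        simp only [Kernel.parallelComp_apply]
    _ = _ := by
        refine lintegral_congr fun x => lintegral_congr fun y => ?_
        rw [lintegral_const_mul' _ _ enorm_ne_top, enorm_condMean_abs hℓ (hB x)]

lemma integral_pairKernel (ν : Measure (Vec p)) [SFinite ν] (hK : Measurable K)
    (hℓ : Measurable (Function.uncurry ℓ))
    (hint : Integrable (pairKernel K h ℓ) ((ν ⊗ₘ κ).prod (ν ⊗ₘ κ))) :
    ∫ u, pairKernel K h ℓ u ∂((ν ⊗ₘ κ).prod (ν ⊗ₘ κ)) =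
      ∫ x, ∫ y, scaled K h (x - y) * condMean κ ℓ x y ∂ν ∂ν := by
  have hs := measurable_scaled hK h
  set F : (Vec p × Vec p) × E × E → ℝ := fun v => scaled K h (v.1.1 - v.1.2) * ℓ v.1.1 v.2
  have hF : Measurable F := by
    have hℓv := hℓ.comp (f := fun v : (Vec p × Vec p) × E × E => (v.1.1, v.2)) (by fun_prop)
    exact Measurable.mul (by fun_prop) hℓv
  have hFint : Integrable F ((ν.prod ν) ⊗ₘ (κ ∥ₖ κ)) := by
    rw [← map_prod_compProd_eq, integrable_map_measure hF.aestronglyMeasurable (by fun_prop)]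
    exact hint
  have hcond : ∀ v : Vec p × Vec p, ∫ w, F (v, w) ∂((κ ∥ₖ κ) v) =
      scaled K h (v.1 - v.2) * condMean κ ℓ v.1 v.2 := fun v => by
    simp only [F, integral_const_mul, Kernel.parallelComp_apply, condMean]
  have hcondint : Integrable (fun v : Vec p × Vec p =>
      scaled K h (v.1 - v.2) * condMean κ ℓ v.1 v.2) (ν.prod ν) := by
    simpa only [Kernel.prodMkLeft_apply, Kernel.const_apply, hcond] using hFint.integral_compProd
  calc ∫ u, pairKernel K h ℓ u ∂((ν ⊗ₘ κ).prod (ν ⊗ₘ κ))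
      = ∫ v, F v ∂((ν.prod ν) ⊗ₘ (κ ∥ₖ κ)) := by
        rw [← map_prod_compProd_eq, integral_map (by fun_prop) hF.aestronglyMeasurable]
        rfl
    _ = ∫ v : Vec p × Vec p, scaled K h (v.1 - v.2) * condMean κ ℓ v.1 v.2 ∂(ν.prod ν) := by
        rw [Measure.integral_compProd hFint]
        simp only [hcond]
    _ = _ := integral_prod _ hcondint

end PairLaw

section DensityBounds

open scoped NNReal

lemma withDensity_compProd {α β : Type*} [MeasurableSpace α] [MeasurableSpace β] (ρ : Measure α)
    [SFinite ρ] (κ : Kernel α β) [IsSFiniteKernel κ] {D : α → ℝ≥0∞} (hD : Measurable D) :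
    (ρ.withDensity D) ⊗ₘ κ = (ρ ⊗ₘ κ).withDensity fun u => D u.1 := by
  refine Measure.ext_of_lintegral _ fun F hF => ?_
  rw [Measure.lintegral_compProd hF,
    lintegral_withDensity_eq_lintegral_mul _ hD hF.lintegral_kernel_prod_right',
    lintegral_withDensity_eq_lintegral_mul _ (by fun_prop) hF,
    Measure.lintegral_compProd (by fun_prop)]
  refine lintegral_congr fun x => ?_
  simp only [Pi.mul_apply]
  rw [lintegral_const_mul _ (by fun_prop)]

lemma measurePreserving_fst_compProd {α β : Type*} [MeasurableSpace α] [MeasurableSpace β]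
    (ρ : Measure α) [SFinite ρ] (κ : Kernel α β) [IsMarkovKernel κ] :
    MeasurePreserving Prod.fst (ρ ⊗ₘ κ) ρ :=
  ⟨measurable_fst, Measure.fst_compProd ρ κ⟩

lemma lintegral_withDensity_le_mul_lintegral {α β : Type*} [MeasurableSpace α] [MeasurableSpace β]
    {ρ : Measure α} {σ : Measure β} {e : α → β} (he : MeasurePreserving e ρ σ) {D : α → ℝ≥0∞}
    (hD : Measurable D) {w : β → ℝ≥0∞} (hw : Measurable w) {F : α → ℝ≥0∞} {C : ℝ≥0∞}
    (hF : ∀ᵐ x ∂ρ, D x * F x ≤ C * w (e x)) :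
    ∫⁻ x, F x ∂(ρ.withDensity D) ≤ C * ∫⁻ t, w t ∂σ :=
  calc ∫⁻ x, F x ∂(ρ.withDensity D) ≤ ∫⁻ x, D x * F x ∂ρ :=
        lintegral_withDensity_le_lintegral_mul ρ hD F
    _ ≤ ∫⁻ x, C * w (e x) ∂ρ := lintegral_mono_ae hF
    _ = C * ∫⁻ t, w t ∂σ := by
        rw [← he.lintegral_comp hw]
        exact lintegral_const_mul C (hw.comp he.measurable)

variable {p : ℕ} {E : Type*} {K : Vec p → ℝ} {h R r : ℝ} {k M : ℝ≥0}
  {ℓ : Vec p → E × E → ℝ} {f : Vec p → ℝ}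

lemma ofReal_mul_enorm_scaled_mul_pow_le (hR : ∀ t, K t ≠ 0 → ‖t‖ ≤ R) (hh : 0 < h)
    (hhR : h * R ≤ 1) (hM : ∀ z, ‖z‖ ≤ r + 1 → f z ≤ M) {x y z : Vec p} (hz : z = x ∨ z = y)
    {a : ℝ} (ha : |a| ≤ (Metric.closedBall 0 r).indicator (fun _ => (k : ℝ)) x) (s : ℕ) :
    ENNReal.ofReal (f z) * ‖scaled K h (x - y) * a‖ₑ ^ (s + 1) ≤
      M * k ^ (s + 1) * ‖scaled K h (x - y)‖ₑ ^ (s + 1) := by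
  rcases eq_or_ne (scaled K h (x - y)) 0 with hs | hs
  · simp [hs]
  by_cases hx : x ∈ Metric.closedBall (0 : Vec p) r
  · rw [Set.indicator_of_mem hx] at ha
    have hxy : ‖y - x‖ ≤ 1 := by
      rw [norm_sub_rev]
      exact (norm_le_of_scaled_ne_zero hR hh hs).trans hhR
    have hzr : ‖z‖ ≤ r + 1 := by
      rw [mem_closedBall_zero_iff] at hx
      rcases hz with rfl | rfl
      · linarith
      · linarith [norm_sub_norm_le z x]
    have hfz : ENNReal.ofReal (f z) ≤ M :=
      ENNReal.ofReal_le_of_le_toReal (by simpa using hM z hzr)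
    have hak : ‖a‖ₑ ≤ k := enorm_le_coe.2 ha
    rw [enorm_mul, mul_pow, mul_comm (_ ^ _), ← mul_assoc]
    gcongr
  · rw [Set.indicator_of_notMem hx, abs_nonpos_iff] at ha
    simp [ha]

variable [MeasurableSpace E] {κ : Kernel (Vec p) E} [IsMarkovKernel κ]
  (hK : Measurable K) (hR : ∀ t, K t ≠ 0 → ‖t‖ ≤ R) (hh : 0 < h) (hhR : h * R ≤ 1)
  (hf : Measurable f) (hM : ∀ z, ‖z‖ ≤ r + 1 → f z ≤ M)
  (hℓ : ∀ z w, |ℓ z w| ≤ (Metric.closedBall 0 r).indicator (fun _ => (k : ℝ)) z)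

include hK hR hh hhR hf hM hℓ

lemma lintegral_fst_enorm_pairKernel_pow_le (s : ℕ) (y' : Vec p × E) :
    ∫⁻ y, ‖pairKernel K h ℓ (y, y')‖ₑ ^ (s + 1) ∂(densityMeasure f ⊗ₘ κ) ≤
      M * k ^ (s + 1) *
        (ENNReal.ofReal (h ^ p)⁻¹ ^ s * ∫⁻ t, ‖K t‖ₑ ^ (s + 1)) := by
  rw [withDensity_compProd _ _ (by fun_prop), ← lintegral_enorm_scaled_pow_succ hK hh]
  exact lintegral_withDensity_le_mul_lintegral
    ((measurePreserving_sub_right volume y'.1).comp (measurePreserving_fst_compProd volume κ))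
    (by fun_prop) ((measurable_scaled hK h).enorm.pow_const _) (ae_of_all _ fun y =>
      ofReal_mul_enorm_scaled_mul_pow_le hR hh hhR hM (.inl rfl) (hℓ _ _) s)

lemma lintegral_snd_enorm_pairKernel_pow_le (s : ℕ) (y : Vec p × E) :
    ∫⁻ y', ‖pairKernel K h ℓ (y, y')‖ₑ ^ (s + 1) ∂(densityMeasure f ⊗ₘ κ) ≤
      M * k ^ (s + 1) *
        (ENNReal.ofReal (h ^ p)⁻¹ ^ s * ∫⁻ t, ‖K t‖ₑ ^ (s + 1)) := by
  rw [withDensity_compProd _ _ (by fun_prop), ← lintegral_enorm_scaled_pow_succ hK hh]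
  exact lintegral_withDensity_le_mul_lintegral
    ((Measure.measurePreserving_sub_left volume y.1).comp (measurePreserving_fst_compProd volume κ))
    (by fun_prop) ((measurable_scaled hK h).enorm.pow_const _) (ae_of_all _ fun y' =>
      ofReal_mul_enorm_scaled_mul_pow_le hR hh hhR hM (.inr rfl) (hℓ _ _) s)

lemma lintegral_enorm_scaled_mul_condMean_le (x : Vec p) :
    ∫⁻ y, ‖scaled K h (x - y) * condMean κ ℓ x y‖ₑ ∂(densityMeasure f) ≤
      M * k * ∫⁻ t, ‖K t‖ₑ := by
  rw [← lintegral_enorm_scaled hK hh]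
  refine lintegral_withDensity_le_mul_lintegral (Measure.measurePreserving_sub_left volume x)
    (by fun_prop) (measurable_scaled hK h).enorm (ae_of_all _ fun y => ?_)
  simpa only [zero_add, pow_one] using
    ofReal_mul_enorm_scaled_mul_pow_le hR hh hhR hM (.inr rfl) (abs_condMean_le (hℓ x) y) 0

lemma hasSectionBound_pairKernel {N : ℝ≥0} (hN : ∫⁻ t, ‖K t‖ₑ ≤ N) :
    HasSectionBound (pairKernel K h ℓ) (densityMeasure f ⊗ₘ κ) (M * k * N) := by
  have hle : M * k * ∫⁻ t, ‖K t‖ₑ ≤ ((M * k * N : ℝ≥0) : ℝ≥0∞) := by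
    push_cast
    gcongr
  exact
    { left := fun y' => le_trans (by simpa using
        lintegral_fst_enorm_pairKernel_pow_le hK hR hh hhR hf hM hℓ 0 y') hle
      right := fun y => le_trans (by simpa using
        lintegral_snd_enorm_pairKernel_pow_le hK hR hh hhR hf hM hℓ 0 y) hle }

lemma lintegral_enorm_pairKernel_sq_le [IsProbabilityMeasure (densityMeasure f)] :
    ∫⁻ u, ‖pairKernel K h ℓ u‖ₑ ^ 2 ∂((densityMeasure f ⊗ₘ κ).prod (densityMeasure f ⊗ₘ κ)) ≤
      M * k ^ 2 * (ENNReal.ofReal (h ^ p)⁻¹ * ∫⁻ t, ‖K t‖ₑ ^ 2) := by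
  refine (lintegral_prod_le _).trans (lintegral_le_const (ae_of_all _ fun y => ?_))
  simpa only [pow_one] using lintegral_snd_enorm_pairKernel_pow_le hK hR hh hhR hf hM hℓ 1 y

end DensityBounds

section BoundedLoss

open scoped NNReal

variable {p : ℕ} {f : Vec p → ℝ}

lemma integral_densityMeasure (hf0 : ∀ z, 0 ≤ f z) (hf : Measurable f) (G : Vec p → ℝ) :
    ∫ z, G z ∂(densityMeasure f) = ∫ z, G z * f z := by
  rw [integral_withDensity_eq_integral_toReal_smul (by fun_prop)
    (ae_of_all _ fun _ => ENNReal.ofReal_lt_top)]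
  simp only [ENNReal.toReal_ofReal (hf0 _), smul_eq_mul, mul_comm]

lemma ae_densityMeasure_iff (hf0 : ∀ z, 0 ≤ f z) (hf : Measurable f) {Q : Vec p → Prop} :
    (∀ᵐ z ∂(densityMeasure f), Q z) ↔ ∀ᵐ z, f z ≠ 0 → Q z := by
  rw [ae_withDensity_iff (by fun_prop)]
  simp only [ne_eq, ENNReal.ofReal_eq_zero, (hf0 _).ge_iff_eq']

lemma exists_forall_norm_le_imp_le (hf : Continuous f) (r : ℝ) :
    ∃ M : ℝ≥0, ∀ z, ‖z‖ ≤ r → f z ≤ M := by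
  obtain ⟨M, hM⟩ := (isCompact_closedBall (0 : Vec p) r).bddAbove_image hf.continuousOn
  exact ⟨M.toNNReal, fun z hz => (hM ⟨z, by simpa using hz, rfl⟩).trans (Real.le_coe_toNNReal M)⟩

variable {E : Type*} [MeasurableSpace E] {κ : Kernel (Vec p) E} [IsMarkovKernel κ] {K : Vec p → ℝ}
  {m : ℕ} {h : ℕ → ℝ} {ℓ : Vec p → E × E → ℝ} {S : Set (Vec p)} {r : ℝ} {k : ℝ≥0}

lemma tendsto_integral_scaled_mul_condMean (hK : IsKernelOfOrder K m)
    (hh : Tendsto h atTop (𝓝[>] 0)) (hf0 : ∀ z, 0 ≤ f z) (hf : Continuous f)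
    (hfS : ∀ᵐ z ∂(densityMeasure f), z ∈ S) (hℓ : Measurable (Function.uncurry ℓ))
    {x : Vec p} (hx : x ∈ S) (hfx : f x ≠ 0) (hcont : ContinuousOn (condMean κ ℓ x) S) :
    Tendsto (fun n => ∫ y, scaled K (h n) (x - y) * condMean κ ℓ x y ∂(densityMeasure f)) atTop
      (𝓝 (condMean κ ℓ x x * f x)) := by
  have hS : S ∈ 𝓝[{y | f y ≠ 0 → y ∈ S}] x := by
    have hfne : ∀ᶠ y in 𝓝 x, f y ≠ 0 := hf.continuousAt.eventually_ne hfx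
    filter_upwards [nhdsWithin_le_nhds hfne, self_mem_nhdsWithin] with y hy hyS using hyS hy
  have hlim : Tendsto (fun y => condMean κ ℓ x y * f y) (𝓝[{y | f y ≠ 0 → y ∈ S}] x)
      (𝓝 (condMean κ ℓ x x * f x)) :=
    ((hcont x hx).mono_left (nhdsWithin_le_iff.2 hS)).mul
      (hf.continuousAt.mono_left nhdsWithin_le_nhds)
  have hmeas : Measurable (condMean κ ℓ x) :=
    (measurable_condMean hℓ).comp (measurable_const.prodMk measurable_id)
  simp only [integral_densityMeasure hf0 hf.measurable, mul_assoc]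
  exact tendsto_integral_scaled_mul hh hK.integrable hK.integral_eq_one hK.compactSupport
    (hmeas.mul hf.measurable).aestronglyMeasurable
    ((ae_densityMeasure_iff hf0 hf.measurable).1 hfS) hlim

lemma isProbabilityMeasure_densityMeasure [IsProbabilityMeasure (densityMeasure f ⊗ₘ κ)] :
    IsProbabilityMeasure (densityMeasure f) := by
  rw [← Measure.fst_compProd (densityMeasure f) κ]
  infer_instance

lemma tendsto_integral_pairKernel [IsProbabilityMeasure (densityMeasure f)]
    (hK : IsKernelOfOrder K m) (hh : Tendsto h atTop (𝓝[>] 0)) (hf0 : ∀ z, 0 ≤ f z)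
    (hf : Continuous f) (hfS : ∀ᵐ z ∂(densityMeasure f), z ∈ S)
    (hℓm : Measurable (Function.uncurry ℓ))
    (hℓ : ∀ z w, |ℓ z w| ≤ (Metric.closedBall 0 r).indicator (fun _ => (k : ℝ)) z)
    (hcont : ∀ x ∈ S, ContinuousOn (condMean κ ℓ x) S) :
    Tendsto (fun n => ∫ x, ∫ y, scaled K (h n) (x - y) * condMean κ ℓ x y
      ∂(densityMeasure f) ∂(densityMeasure f)) atTop (𝓝 (∫ z, condMean κ ℓ z z * f z ^ 2)) := by
  obtain ⟨R, hR⟩ := exists_norm_le_of_hasCompactSupport hK.compactSupport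
  obtain ⟨M, hM⟩ := exists_forall_norm_le_imp_le hf (r + 1)
  have hlim : ∫ z, condMean κ ℓ z z * f z ^ 2 =
      ∫ z, condMean κ ℓ z z * f z ∂(densityMeasure f) := by
    rw [integral_densityMeasure hf0 hf.measurable]
    simp only [pow_two, mul_assoc]
  have hmeas := measurable_condMean (κ := κ) hℓm
  rw [hlim]
  refine tendsto_integral_filter_of_dominated_convergence
    (fun _ => (M * k * ∫⁻ t, ‖K t‖ₑ).toReal) (.of_forall fun n => ?_) ?_
    (integrable_const _) ?_
  · have hs := measurable_scaled hK.measurable (h n)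
    have hG : Measurable fun v : Vec p × Vec p =>
        scaled K (h n) (v.1 - v.2) * condMean κ ℓ v.1 v.2 := by fun_prop
    exact hG.stronglyMeasurable.integral_prod_right'.aestronglyMeasurable
  · filter_upwards [eventually_mul_lt hh R one_pos, hh self_mem_nhdsWithin] with n hhR hpos
    refine ae_of_all _ fun x => (norm_integral_le_lintegral_norm _).trans
      (ENNReal.toReal_mono (by finiteness [hK.integrable.2.ne]) ?_)
    simpa only [ofReal_norm] using lintegral_enorm_scaled_mul_condMean_le
      hK.measurable hR hpos hhR.le hf.measurable hM hℓ x
  · filter_upwards [hfS, (ae_densityMeasure_iff hf0 hf.measurable).2 (ae_of_all _ fun _ => id)]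
      with x hx hfx
    exact tendsto_integral_scaled_mul_condMean hK hh hf0 hf hfS hℓm hx hfx (hcont x hx)

theorem tendstoInMeasure_uStat_pairKernel_of_bounded {Ω : Type*} [MeasurableSpace Ω] {P : Measure Ω}
    {Y : ℕ → Ω → Vec p × E} (hY : IsIIDSample Y (densityMeasure f ⊗ₘ κ) P)
    (hK : IsKernelOfOrder K m) (hh : Tendsto h atTop (𝓝[>] 0))
    (hrate : Tendsto (fun n : ℕ => (n : ℝ) ^ 2 * h n ^ p) atTop atTop)
    (hf0 : ∀ z, 0 ≤ f z) (hf : Continuous f)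
    (hfS : ∀ᵐ z ∂(densityMeasure f), z ∈ S) (hℓm : Measurable (Function.uncurry ℓ))
    (hℓ : ∀ z w, |ℓ z w| ≤ (Metric.closedBall 0 r).indicator (fun _ => (k : ℝ)) z)
    (hcont : ∀ x ∈ S, ContinuousOn (condMean κ ℓ x) S) :
    TendstoInMeasure P (fun n ω => uStat n (pairKernel K (h n) ℓ) (fun i => Y i ω)) atTop
      (fun _ => ∫ z, condMean κ ℓ z z * f z ^ 2) := by
  have := hY.isProbabilityMeasure_law
  have := isProbabilityMeasure_densityMeasure (f := f) (κ := κ)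
  obtain ⟨R, hR⟩ := exists_norm_le_of_hasCompactSupport hK.compactSupport
  obtain ⟨M, hM⟩ := exists_forall_norm_le_imp_le hf (r + 1)
  lift ∫⁻ t, ‖K t‖ₑ to ℝ≥0 using hK.integrable.2.ne with N₁ hN₁
  lift ∫⁻ t, ‖K t‖ₑ ^ 2 to ℝ≥0 using hK.lintegral_enorm_sq_ne_top with N₂ hN₂
  have hsmall : ∀ᶠ n in atTop, 0 < h n ∧ h n * R ≤ 1 := by
    filter_upwards [eventually_mul_lt hh R one_pos, hh self_mem_nhdsWithin] with n hhR hpos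
      using ⟨hpos, hhR.le⟩
  have hbound : ∀ᶠ n in atTop,
      HasSectionBound (pairKernel K (h n) ℓ) (densityMeasure f ⊗ₘ κ) (M * k * N₁) :=
    hsmall.mono fun n hn =>
      hasSectionBound_pairKernel hK.measurable hR hn.1 hn.2 hf.measurable hM hℓ hN₁.ge
  have hsq : ∀ᶠ n in atTop, ∫⁻ u, ‖pairKernel K (h n) ℓ u‖ₑ ^ 2
      ∂((densityMeasure f ⊗ₘ κ).prod (densityMeasure f ⊗ₘ κ)) ≤
      (M * k ^ 2 * ((h n ^ p)⁻¹.toNNReal * N₂) : ℝ≥0) :=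
    hsmall.mono fun n hn => by
      push_cast
      rw [hN₂]
      exact lintegral_enorm_pairKernel_sq_le hK.measurable hR hn.1 hn.2 hf.measurable hM hℓ
  have hsqlim : Tendsto (fun n : ℕ =>
      ((M * k ^ 2 * ((h n ^ p)⁻¹.toNNReal * N₂) : ℝ≥0) : ℝ) / (n : ℝ) ^ 2) atTop (𝓝 0) := by
    have hlim := hrate.inv_tendsto_atTop.const_mul ((M : ℝ) * k ^ 2 * N₂)
    rw [mul_zero] at hlim
    refine hlim.congr' (hsmall.mono fun n hn => ?_)
    have hp : (0 : ℝ) ≤ (h n ^ p)⁻¹ := by have := hn.1; positivity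
    push_cast
    rw [Real.coe_toNNReal _ hp, Pi.inv_apply, mul_inv]
    ring
  refine hY.tendstoInMeasure_uStat (fun n => measurable_pairKernel hK.measurable hℓm (h n))
    hbound hsq hsqlim ?_
  refine (tendsto_integral_pairKernel hK hh hf0 hf hfS hℓm hℓ hcont).congr'
    (hsq.mono fun n hn => (integral_pairKernel _ hK.measurable hℓm ?_).symm)
  exact (memLp_two_of_lintegral_enorm_sq_le
    (measurable_pairKernel hK.measurable hℓm _).aestronglyMeasurable hn).integrable one_le_two

end BoundedLoss

section Envelope

lemma enorm_le_locSup {α : Type*} [PseudoMetricSpace α] {S : Set α} {ε : ℝ} {F : α → ℝ} {x t : α}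
    (ht : t ∈ S) (hd : dist x t < ε) : ‖F t‖ₑ ≤ locSup S ε F x := by
  rw [Real.enorm_eq_ofReal_abs]
  exact le_iSup₂_of_le (f := fun t (_ : t ∈ {t | t ∈ S ∧ dist x t < ε}) => ENNReal.ofReal |F t|)
    t ⟨ht, hd⟩ le_rfl

variable {p : ℕ} {S : Set (Vec p)} {ε : ℝ} {f : Vec p → ℝ} {φ : Vec p → Vec p → ℝ}

/-- The integrand `φ(x, ·)_ε(x) f_ε(x) f(x)` of the integrability condition on a conditional mean
`φ`: it dominates both `φ(x, x) f(x)²` and its smoothed versions with bandwidth below `ε`. -/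
noncomputable def envelope (S : Set (Vec p)) (ε : ℝ) (f : Vec p → ℝ) (φ : Vec p → Vec p → ℝ)
    (x : Vec p) : ℝ≥0∞ :=
  locSup S ε (φ x) x * locSup Set.univ ε f x * ENNReal.ofReal (f x)

lemma ofReal_le_locSup_univ {x y : Vec p} (hd : dist x y < ε) :
    ENNReal.ofReal (f y) ≤ locSup Set.univ ε f x :=
  (Real.ofReal_le_enorm _).trans (enorm_le_locSup (Set.mem_univ y) hd)

lemma enorm_mul_ofReal_sq_le_envelope (hε : 0 < ε) {x : Vec p} (hx : x ∈ S) :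
    ‖φ x x‖ₑ * ENNReal.ofReal (f x) ^ 2 ≤ envelope S ε f φ x := by
  have hd : dist x x < ε := by rwa [dist_self]
  rw [pow_two, ← mul_assoc, envelope]
  gcongr
  exacts [enorm_le_locSup hx hd, ofReal_le_locSup_univ hd]

lemma ofReal_mul_lintegral_scaled_le_envelope {K : Vec p → ℝ} (hK : Measurable K) {R h : ℝ}
    (hR : ∀ t, K t ≠ 0 → ‖t‖ ≤ R) (hh : 0 < h) (hhR : h * R < ε) (hf0 : ∀ z, 0 ≤ f z)
    (hf : Measurable f) (hfS : ∀ᵐ z ∂(densityMeasure f), z ∈ S) (x : Vec p) :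
    ENNReal.ofReal (f x) * ∫⁻ y, ‖scaled K h (x - y)‖ₑ * ‖φ x y‖ₑ ∂(densityMeasure f) ≤
      (∫⁻ t, ‖K t‖ₑ) * envelope S ε f φ x := by
  have hsup : ∫⁻ y, ‖scaled K h (x - y)‖ₑ * ‖φ x y‖ₑ ∂(densityMeasure f) ≤
      locSup S ε (φ x) x * locSup Set.univ ε f x * ∫⁻ z, ‖scaled K h z‖ₑ := by
    refine lintegral_withDensity_le_mul_lintegral (Measure.measurePreserving_sub_left volume x)
      (by fun_prop) (measurable_scaled hK h).enorm ?_
    filter_upwards [(ae_densityMeasure_iff hf0 hf).1 hfS] with y hy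
    rcases eq_or_ne (scaled K h (x - y)) 0 with hs | hs
    · simp [hs]
    rcases eq_or_ne (f y) 0 with hfy | hfy
    · simp [hfy]
    have hd : dist x y < ε := by
      rw [dist_eq_norm]
      exact (norm_le_of_scaled_ne_zero hR hh hs).trans_lt hhR
    calc ENNReal.ofReal (f y) * (‖scaled K h (x - y)‖ₑ * ‖φ x y‖ₑ)
        = ‖φ x y‖ₑ * ENNReal.ofReal (f y) * ‖scaled K h (x - y)‖ₑ := by ring
      _ ≤ _ := by
        gcongr
        exacts [enorm_le_locSup (hy hfy) hd, ofReal_le_locSup_univ hd]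
  calc ENNReal.ofReal (f x) * ∫⁻ y, ‖scaled K h (x - y)‖ₑ * ‖φ x y‖ₑ ∂(densityMeasure f)
      ≤ ENNReal.ofReal (f x) * (locSup S ε (φ x) x * locSup Set.univ ε f x *
          ∫⁻ z, ‖scaled K h z‖ₑ) := by gcongr
    _ = _ := by
      rw [lintegral_enorm_scaled hK hh, envelope]
      ring

lemma exists_nat_setLIntegral_lt_le {α : Type*} [MeasurableSpace α] {μ : Measure α}
    {Φ : α → ℝ≥0∞} (hΦ : ∫⁻ x, Φ x ∂μ ≠ ∞) {ρ : α → ℝ} (hρ : Measurable ρ) {δ : ℝ≥0∞}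
    (hδ : δ ≠ 0) : ∃ k : ℕ, ∫⁻ x in {x | (k : ℝ) < ρ x}, Φ x ∂μ ≤ δ := by
  have hmeas : ∀ k : ℕ, MeasurableSet {x | (k : ℝ) < ρ x} := fun k =>
    measurableSet_lt measurable_const hρ
  have hanti : Antitone fun k : ℕ => {x | (k : ℝ) < ρ x} :=
    fun i j hij x (hx : (j : ℝ) < ρ x) => (lt_of_le_of_lt (Nat.cast_le.2 hij) hx : (i : ℝ) < ρ x)
  have hinter : ⋂ k : ℕ, {x | (k : ℝ) < ρ x} = ∅ := by
    refine Set.eq_empty_of_forall_notMem fun x hx => ?_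
    obtain ⟨k, hk⟩ := exists_nat_ge (ρ x)
    exact hk.not_gt (Set.mem_iInter.1 hx k)
  have hfin : μ.withDensity Φ {x | ((0 : ℕ) : ℝ) < ρ x} ≠ ∞ := by
    rw [withDensity_apply _ (hmeas 0)]
    exact ne_top_of_le_ne_top hΦ (setLIntegral_le_lintegral _ _)
  have hlim := tendsto_measure_iInter_atTop (μ := μ.withDensity Φ)
    (fun k => (hmeas k).nullMeasurableSet) hanti ⟨0, hfin⟩
  rw [hinter, measure_empty] at hlim
  obtain ⟨k, hk⟩ := (hlim.eventually_le_const (pos_iff_ne_zero.2 hδ)).exists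
  exact ⟨k, by rwa [Function.comp_apply, withDensity_apply _ (hmeas k)] at hk⟩

end Envelope

section UnboundedLoss

open scoped NNReal

variable {p : ℕ} {E : Type*} [MeasurableSpace E] {κ : Kernel (Vec p) E} [IsMarkovKernel κ]
  {K f B : Vec p → ℝ} {m : ℕ} {ℓ : Vec p → E × E → ℝ} {S : Set (Vec p)} {ε : ℝ}

lemma lintegral_enorm_pairKernel_indicator_le {R h : ℝ} (hK : Measurable K)
    (hKfin : ∫⁻ t, ‖K t‖ₑ ≠ ∞) (hR : ∀ t, K t ≠ 0 → ‖t‖ ≤ R) (hh : 0 < h) (hhR : h * R < ε)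
    (hf0 : ∀ z, 0 ≤ f z) (hf : Measurable f) (hfS : ∀ᵐ z ∂(densityMeasure f), z ∈ S)
    (hℓ : Measurable (Function.uncurry ℓ)) (hB : ∀ z w, |ℓ z w| ≤ B z) {T : Set (Vec p)}
    (hT : MeasurableSet T) :
    ∫⁻ u, ‖pairKernel K h (T.indicator ℓ) u‖ₑ
        ∂((densityMeasure f ⊗ₘ κ).prod (densityMeasure f ⊗ₘ κ)) ≤
      (∫⁻ t, ‖K t‖ₑ) * ∫⁻ x in T, envelope S ε f (condMean κ fun z w => |ℓ z w|) x := by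
  set φ := condMean κ fun z w => |ℓ z w|
  have habs : (fun z w => |T.indicator ℓ z w|) = T.indicator fun z w => |ℓ z w| := by
    funext z w
    by_cases hz : z ∈ T <;> simp [hz]
  have hBT : ∀ z w, |T.indicator ℓ z w| ≤ B z := fun z w => by
    by_cases hz : z ∈ T
    · simpa [hz] using hB z w
    · simpa [hz] using (abs_nonneg _).trans (hB z w)
  calc ∫⁻ u, ‖pairKernel K h (T.indicator ℓ) u‖ₑ
        ∂((densityMeasure f ⊗ₘ κ).prod (densityMeasure f ⊗ₘ κ))
      = ∫⁻ x, T.indicator (fun x => ∫⁻ y, ‖scaled K h (x - y)‖ₑ * ‖φ x y‖ₑ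
          ∂(densityMeasure f)) x ∂(densityMeasure f) := by
        rw [lintegral_enorm_pairKernel _ hK (measurable_uncurry_indicator hℓ hT) hBT, habs,
          condMean_indicator]
        refine lintegral_congr fun x => ?_
        by_cases hx : x ∈ T <;> simp [hx, φ]
    _ ≤ ∫⁻ x in T, ENNReal.ofReal (f x) * ∫⁻ y, ‖scaled K h (x - y)‖ₑ * ‖φ x y‖ₑ
          ∂(densityMeasure f) := by
        refine (lintegral_withDensity_le_lintegral_mul _ (by fun_prop) _).trans_eq ?_
        rw [← lintegral_indicator hT]
        refine lintegral_congr fun x => ?_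
        by_cases hx : x ∈ T <;> simp [hx]
    _ ≤ ∫⁻ x in T, (∫⁻ t, ‖K t‖ₑ) * envelope S ε f φ x := lintegral_mono fun x =>
        ofReal_mul_lintegral_scaled_le_envelope hK hR hh hhR hf0 hf hfS x
    _ = _ := lintegral_const_mul' _ _ hKfin

lemma enorm_condMean_mul_sq_le_envelope (hε : 0 < ε) (hf0 : ∀ z, 0 ≤ f z)
    (hℓ : Measurable (Function.uncurry ℓ)) (hB : ∀ z w, |ℓ z w| ≤ B z) {x : Vec p}
    (hx : f x ≠ 0 → x ∈ S) :
    ‖condMean κ ℓ x x * f x ^ 2‖ₑ ≤ envelope S ε f (condMean κ fun z w => |ℓ z w|) x := by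
  rcases eq_or_ne (f x) 0 with hfx | hfx
  · simp [hfx]
  calc ‖condMean κ ℓ x x * f x ^ 2‖ₑ
      = ‖condMean κ ℓ x x‖ₑ * ENNReal.ofReal (f x) ^ 2 := by
        rw [enorm_mul, enorm_pow, Real.enorm_of_nonneg (hf0 x)]
    _ ≤ ‖condMean κ (fun z w => |ℓ z w|) x x‖ₑ * ENNReal.ofReal (f x) ^ 2 := by
        rw [enorm_condMean_abs hℓ (hB x)]
        gcongr
        exact enorm_integral_le_lintegral_enorm _
    _ ≤ _ := enorm_mul_ofReal_sq_le_envelope hε (hx hfx)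

lemma integrable_condMean_mul_sq (hε : 0 < ε) (hf0 : ∀ z, 0 ≤ f z) (hf : Measurable f)
    (hfS : ∀ᵐ z ∂(densityMeasure f), z ∈ S) (hℓ : Measurable (Function.uncurry ℓ))
    (hB : ∀ z w, |ℓ z w| ≤ B z)
    (hint : ∫⁻ x, envelope S ε f (condMean κ fun z w => |ℓ z w|) x ≠ ∞) :
    Integrable fun z => condMean κ ℓ z z * f z ^ 2 := by
  have hmeas : Measurable fun z : Vec p => condMean κ ℓ z z :=
    (measurable_condMean hℓ).comp (f := fun z : Vec p => (z, z)) (by fun_prop)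
  refine ⟨(hmeas.mul (hf.pow_const 2)).aestronglyMeasurable,
    (lintegral_mono_ae ?_).trans_lt hint.lt_top⟩
  filter_upwards [(ae_densityMeasure_iff hf0 hf).1 hfS] with x hx
  exact enorm_condMean_mul_sq_le_envelope hε hf0 hℓ hB hx

lemma dist_integral_condMean_indicator_le (hε : 0 < ε) (hf0 : ∀ z, 0 ≤ f z) (hf : Measurable f)
    (hfS : ∀ᵐ z ∂(densityMeasure f), z ∈ S) (hℓ : Measurable (Function.uncurry ℓ))
    (hB : ∀ z w, |ℓ z w| ≤ B z)
    (hint : ∫⁻ x, envelope S ε f (condMean κ fun z w => |ℓ z w|) x ≠ ∞) {T : Set (Vec p)}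
    (hT : MeasurableSet T) {δ : ℝ} (hδ : 0 ≤ δ)
    (hTδ : ∫⁻ x in Tᶜ, envelope S ε f (condMean κ fun z w => |ℓ z w|) x ≤ ENNReal.ofReal δ) :
    dist (∫ z, condMean κ (T.indicator ℓ) z z * f z ^ 2) (∫ z, condMean κ ℓ z z * f z ^ 2) ≤ δ := by
  have hind : ∫ z, condMean κ (T.indicator ℓ) z z * f z ^ 2 =
      ∫ z in T, condMean κ ℓ z z * f z ^ 2 := by
    rw [← integral_indicator hT, condMean_indicator]
    congr 1 with z
    by_cases hz : z ∈ T <;> simp [hz]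
  rw [hind, ← integral_add_compl hT (integrable_condMean_mul_sq hε hf0 hf hfS hℓ hB hint),
    dist_self_add_right]
  refine (norm_integral_le_lintegral_norm _).trans (ENNReal.toReal_le_of_le_ofReal hδ ?_)
  refine (lintegral_mono_ae ?_).trans hTδ
  filter_upwards [ae_restrict_of_ae ((ae_densityMeasure_iff hf0 hf).1 hfS)] with x hx
  rw [ofReal_norm]
  exact enorm_condMean_mul_sq_le_envelope hε hf0 hℓ hB hx

variable {Ω : Type*} [MeasurableSpace Ω] {P : Measure Ω} {Y : ℕ → Ω → Vec p × E}

lemma lintegral_enorm_uStat_sub_indicator_le (hY : IsIIDSample Y (densityMeasure f ⊗ₘ κ) P)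
    (hK : IsKernelOfOrder K m) {R h : ℝ} (hR : ∀ t, K t ≠ 0 → ‖t‖ ≤ R) (hh : 0 < h)
    (hhR : h * R < ε) (hf0 : ∀ z, 0 ≤ f z) (hf : Measurable f)
    (hfS : ∀ᵐ z ∂(densityMeasure f), z ∈ S) (hℓ : Measurable (Function.uncurry ℓ))
    (hB : ∀ z w, |ℓ z w| ≤ B z) {T : Set (Vec p)} (hT : MeasurableSet T) (n : ℕ) :
    ∫⁻ ω, ‖uStat n (pairKernel K h ℓ) (fun i => Y i ω) -
        uStat n (pairKernel K h (T.indicator ℓ)) (fun i => Y i ω)‖ₑ ∂P ≤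
      (∫⁻ t, ‖K t‖ₑ) * ∫⁻ x in Tᶜ, envelope S ε f (condMean κ fun z w => |ℓ z w|) x := by
  simp only [← uStat_sub, pairKernel_sub_indicator]
  exact (hY.lintegral_enorm_uStat_le (measurable_pairKernel hK.measurable
    (measurable_uncurry_indicator hℓ hT.compl) h) n).trans
    (lintegral_enorm_pairKernel_indicator_le hK.measurable hK.integrable.2.ne hR hh hhR hf0 hf hfS
      hℓ hB hT.compl)

lemma tendstoInMeasure_uStat_pairKernel_indicator
    (hY : IsIIDSample Y (densityMeasure f ⊗ₘ κ) P)
    (hK : IsKernelOfOrder K m) {h : ℕ → ℝ} (hh : Tendsto h atTop (𝓝[>] 0))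
    (hrate : Tendsto (fun n : ℕ => (n : ℝ) ^ 2 * h n ^ p) atTop atTop)
    (hf0 : ∀ z, 0 ≤ f z) (hf : Continuous f)
    (hfS : ∀ᵐ z ∂(densityMeasure f), z ∈ S) (hℓ : Measurable (Function.uncurry ℓ))
    (hcont : ∀ x ∈ S, ContinuousOn (condMean κ ℓ x) S) {T : Set (Vec p)} (hT : MeasurableSet T)
    {r : ℝ} {k : ℝ≥0} (hTr : ∀ z ∈ T, ‖z‖ ≤ r) (hTk : ∀ z ∈ T, ∀ w, |ℓ z w| ≤ k) :
    TendstoInMeasure P (fun n ω => uStat n (pairKernel K (h n) (T.indicator ℓ)) (fun i => Y i ω))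
      atTop (fun _ => ∫ z, condMean κ (T.indicator ℓ) z z * f z ^ 2) := by
  refine tendstoInMeasure_uStat_pairKernel_of_bounded (r := r) (k := k) hY hK hh hrate hf0 hf hfS
    (measurable_uncurry_indicator hℓ hT) (fun z w => ?_) fun x hx => ?_
  · by_cases hz : z ∈ T
    · simpa [hz, hTr z hz] using hTk z hz w
    · simpa [hz] using Set.indicator_nonneg (fun _ _ => k.coe_nonneg) z
  · rw [condMean_indicator]
    by_cases hxT : x ∈ T
    · rw [Set.indicator_of_mem hxT]
      exact hcont x hx
    · rw [Set.indicator_of_notMem hxT]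
      exact continuousOn_const

theorem tendstoInMeasure_uStat_pairKernel (hY : IsIIDSample Y (densityMeasure f ⊗ₘ κ) P)
    (hK : IsKernelOfOrder K m) {h : ℕ → ℝ} (hh : Tendsto h atTop (𝓝[>] 0))
    (hrate : Tendsto (fun n : ℕ => (n : ℝ) ^ 2 * h n ^ p) atTop atTop)
    (hf0 : ∀ z, 0 ≤ f z) (hf : Continuous f)
    (hfS : ∀ᵐ z ∂(densityMeasure f), z ∈ S) (hℓ : Measurable (Function.uncurry ℓ))
    (hBm : Measurable B) (hB : ∀ z w, |ℓ z w| ≤ B z)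
    (hcont : ∀ x ∈ S, ContinuousOn (condMean κ ℓ x) S) (hε : 0 < ε)
    (hint : ∫⁻ x, envelope S ε f (condMean κ fun z w => |ℓ z w|) x ≠ ∞) :
    TendstoInMeasure P (fun n ω => uStat n (pairKernel K (h n) ℓ) (fun i => Y i ω)) atTop
      (fun _ => ∫ z, condMean κ ℓ z z * f z ^ 2) := by
  obtain ⟨R, hR⟩ := exists_norm_le_of_hasCompactSupport hK.compactSupport
  set φ := condMean κ fun z w => |ℓ z w|
  set N := ∫⁻ t, ‖K t‖ₑ
  have hN : N ≠ ∞ := hK.integrable.2.ne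
  refine tendstoInMeasure_of_forall_exists_approx fun δ hδ => ?_
  -- Truncating the loss where it or its location is large costs at most `δ`, uniformly in `n`.
  obtain ⟨k, hk⟩ := exists_nat_setLIntegral_lt_le (Φ := fun x => (N + 1) * envelope S ε f φ x)
    (ρ := fun x => max ‖x‖ (B x)) (δ := ENNReal.ofReal δ)
    (by rw [lintegral_const_mul' _ _ (by finiteness)]; finiteness) (by fun_prop)
    (ENNReal.ofReal_pos.2 hδ).ne'
  rw [lintegral_const_mul' _ _ (by finiteness)] at hk
  set T : Set (Vec p) := {x | (k : ℝ) < max ‖x‖ (B x)}ᶜ with hTdef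
  have hT : MeasurableSet T := (measurableSet_lt (by fun_prop) (by fun_prop)).compl
  rw [← compl_compl {x | (k : ℝ) < max ‖x‖ (B x)}, ← hTdef] at hk
  have hmem : ∀ x ∈ T, ‖x‖ ≤ k ∧ B x ≤ k := fun x hx => max_le_iff.1 (not_lt.1 hx)
  refine ⟨_, _, tendstoInMeasure_uStat_pairKernel_indicator (r := k) (k := k) hY hK hh hrate hf0 hf
    hfS hℓ hcont hT (fun z hz => (hmem z hz).1) fun z hz w => (hB z w).trans (hmem z hz).2, ?_, ?_⟩
  · exact dist_integral_condMean_indicator_le hε hf0 hf.measurable hfS hℓ hB hint hT hδ.le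
      ((le_mul_of_one_le_left' le_add_self).trans hk)
  · filter_upwards [eventually_mul_lt hh R hε, hh self_mem_nhdsWithin] with n hhR hpos
    have hmeas : ∀ ℓ' : Vec p → E × E → ℝ, Measurable (Function.uncurry ℓ') →
        AEStronglyMeasurable (fun ω => uStat n (pairKernel K (h n) ℓ') (fun i => Y i ω)) P :=
      fun ℓ' hℓ' => (hY.measurable_uStat
        (measurable_pairKernel hK.measurable hℓ' _) n).aestronglyMeasurable
    exact ⟨(hmeas ℓ hℓ).sub (hmeas _ (measurable_uncurry_indicator hℓ hT)),
      (lintegral_enorm_uStat_sub_indicator_le hY hK hR hpos hhR hf0 hf.measurable hfS hℓ hB hT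
        n).trans ((mul_le_mul_left le_self_add _).trans hk)⟩

end UnboundedLoss

section Model

variable {p d : ℕ} {g : ℝ → ℝ} {ψ : Vec p → Vec d} {b : Vec d} {S : Set (Vec p)}

lemma q_mem_Ioo (hg : ∀ t, g t ∈ Set.Ioo (-1 : ℝ) 1) (x : Vec p) (b : Vec d) :
    q g ψ x b ∈ Set.Ioo (0 : ℝ) 1 := by
  obtain ⟨hlo, hhi⟩ := hg (∑ k, ψ x k * b k)
  rw [q]
  constructor <;> linarith

open Classical in
lemma logLik_W (x y : ℝ × ℝ) (z : Vec p) :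
    logLik g ψ b (W x y) z =
      if Concordant x y then Real.log (q g ψ z b) else Real.log (1 - q g ψ z b) := by
  rw [logLik, W]
  split_ifs <;> ring

lemma logLik_W_nonpos (hg : ∀ t, g t ∈ Set.Ioo (-1 : ℝ) 1) (x y : ℝ × ℝ) (z : Vec p) :
    logLik g ψ b (W x y) z ≤ 0 := by
  obtain ⟨hpos, hlt⟩ := q_mem_Ioo (ψ := ψ) hg z b
  rw [logLik_W]
  split_ifs
  · exact Real.log_nonpos hpos.le hlt.le
  · exact Real.log_nonpos (sub_nonneg.2 hlt.le) (by linarith)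

lemma measurableSet_concordant : MeasurableSet {u : (ℝ × ℝ) × (ℝ × ℝ) | Concordant u.1 u.2} :=
  measurableSet_lt measurable_const (by fun_prop)

/-- The log-likelihood of the sign of a pair of observations, as a loss set to zero outside of the
set `S` on which the regularity of `q` is assumed. -/
noncomputable def localLogLik (g : ℝ → ℝ) (ψ : Vec p → Vec d) (S : Set (Vec p)) (b : Vec d) :
    Vec p → (ℝ × ℝ) × (ℝ × ℝ) → ℝ :=
  S.indicator fun z w => logLik g ψ b (W w.1 w.2) z

lemma measurable_indicator_of_continuousOn {F : Vec p → ℝ} (hF : ContinuousOn F S)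
    (hS : MeasurableSet S) : Measurable (S.indicator F) := by
  classical
  rw [← Set.piecewise_eq_indicator]
  exact hF.measurable_piecewise continuousOn_const hS

lemma measurable_indicator_log_q (hg : ∀ t, g t ∈ Set.Ioo (-1 : ℝ) 1) (hS : MeasurableSet S)
    (hq : ContinuousOn (fun x => q g ψ x b) S) :
    Measurable (S.indicator fun z => Real.log (q g ψ z b)) :=
  measurable_indicator_of_continuousOn (hq.log fun z _ => (q_mem_Ioo hg z b).1.ne') hS

lemma measurable_indicator_log_one_sub_q (hg : ∀ t, g t ∈ Set.Ioo (-1 : ℝ) 1)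
    (hS : MeasurableSet S) (hq : ContinuousOn (fun x => q g ψ x b) S) :
    Measurable (S.indicator fun z => Real.log (1 - q g ψ z b)) :=
  measurable_indicator_of_continuousOn
    ((continuousOn_const.sub hq).log fun z _ => (sub_pos.2 (q_mem_Ioo hg z b).2).ne') hS

open Classical in
lemma localLogLik_apply (z : Vec p) (w : (ℝ × ℝ) × (ℝ × ℝ)) :
    localLogLik g ψ S b z w =
      if Concordant w.1 w.2 then S.indicator (fun z => Real.log (q g ψ z b)) z
      else S.indicator (fun z => Real.log (1 - q g ψ z b)) z := by
  by_cases hz : z ∈ S <;> simp [localLogLik, logLik_W, hz]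

lemma localLogLik_nonpos (hg : ∀ t, g t ∈ Set.Ioo (-1 : ℝ) 1) (z : Vec p)
    (w : (ℝ × ℝ) × (ℝ × ℝ)) : localLogLik g ψ S b z w ≤ 0 := by
  by_cases hz : z ∈ S
  · simpa [localLogLik, hz] using logLik_W_nonpos hg w.1 w.2 z
  · simp [localLogLik, hz]

lemma measurable_localLogLik (hg : ∀ t, g t ∈ Set.Ioo (-1 : ℝ) 1) (hS : MeasurableSet S)
    (hq : ContinuousOn (fun x => q g ψ x b) S) :
    Measurable (Function.uncurry (localLogLik g ψ S b)) := by
  classical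
  simp only [Function.uncurry_def, localLogLik_apply]
  exact Measurable.ite (measurable_snd measurableSet_concordant)
    ((measurable_indicator_log_q hg hS hq).comp measurable_fst)
    ((measurable_indicator_log_one_sub_q hg hS hq).comp measurable_fst)

lemma exists_measurable_abs_localLogLik_le (hg : ∀ t, g t ∈ Set.Ioo (-1 : ℝ) 1)
    (hS : MeasurableSet S) (hq : ContinuousOn (fun x => q g ψ x b) S) :
    ∃ B : Vec p → ℝ, Measurable B ∧ ∀ z w, |localLogLik g ψ S b z w| ≤ B z := by
  refine ⟨_, (measurable_indicator_log_q hg hS hq).abs.max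
    (measurable_indicator_log_one_sub_q hg hS hq).abs, fun z w => ?_⟩
  rw [localLogLik_apply]
  split_ifs
  exacts [le_max_left _ _, le_max_right _ _]

lemma Ln_eq_uStat {K : Vec p → ℝ} {h : ℝ} {z : ℕ → Vec p} {x : ℕ → ℝ × ℝ} (hz : ∀ i, z i ∈ S)
    (n : ℕ) :
    Ln K g ψ n h z x b =
      uStat n (pairKernel K h (localLogLik g ψ S b)) fun i => (z i, x i) := by
  have hoff : (Finset.range n).offDiag =
      (Finset.range n ×ˢ Finset.range n).filter fun a => a.1 ≠ a.2 := by
    ext a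
    simp [Finset.mem_offDiag, and_assoc]
  rw [Ln, uStat, hoff, Finset.sum_filter, Finset.sum_product]
  simp only [pairKernel, localLogLik, Set.indicator_of_mem (hz _), Finset.sum_filter]

variable {κ : Kernel (Vec p) (ℝ × ℝ)} [IsMarkovKernel κ]

lemma condMean_logLik_W :
    condMean κ (fun z w => logLik g ψ b (W w.1 w.2) z) = fun x y => phi κ g ψ x y b := by
  classical
  funext x y
  have hind : (fun w : (ℝ × ℝ) × (ℝ × ℝ) => logLik g ψ b (W w.1 w.2) x) = fun w =>
      {w | Concordant w.1 w.2}.indicator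
        (fun _ => Real.log (q g ψ x b) - Real.log (1 - q g ψ x b)) w +
      Real.log (1 - q g ψ x b) := by
    funext w
    by_cases hw : Concordant w.1 w.2 <;> simp [logLik_W, hw]
  rw [condMean, hind, integral_add ((integrable_const _).indicator measurableSet_concordant)
    (integrable_const _), integral_indicator_const _ measurableSet_concordant]
  simp only [integral_const, probReal_univ, smul_eq_mul, phi, prob2]
  ring

lemma condMean_localLogLik :
    condMean κ (localLogLik g ψ S b) = S.indicator fun x y => phi κ g ψ x y b := by
  rw [localLogLik, condMean_indicator, condMean_logLik_W]

lemma envelope_condMean_abs_localLogLik_le (hg : ∀ t, g t ∈ Set.Ioo (-1 : ℝ) 1) (ε : ℝ)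
    (f : Vec p → ℝ) (x : Vec p) :
    envelope S ε f (condMean κ fun z w => |localLogLik g ψ S b z w|) x ≤
      envelope S ε f (fun x y => phi κ g ψ x y b) x := by
  have hneg : condMean κ (fun z w => |localLogLik g ψ S b z w|) x =
      -S.indicator (fun x y => phi κ g ψ x y b) x := by
    funext y
    simp only [← condMean_localLogLik, condMean, Pi.neg_apply,
      abs_of_nonpos (localLogLik_nonpos hg _ _), integral_neg]
  have hle : locSup S ε (condMean κ (fun z w => |localLogLik g ψ S b z w|) x) x ≤
      locSup S ε (fun y => phi κ g ψ x y b) x := by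
    rw [hneg]
    by_cases hx : x ∈ S <;> simp [locSup, hx]
  rw [envelope, envelope]
  gcongr

variable {f : Vec p → ℝ} {ε : ℝ}

lemma condMean_localLogLik_mul_sq_ae_eq (hf0 : ∀ z, 0 ≤ f z) (hf : Measurable f)
    (hfS : ∀ᵐ z ∂(densityMeasure f), z ∈ S) :
    (fun z => condMean κ (localLogLik g ψ S b) z z * f z ^ 2) =ᵐ[volume]
      fun z => phi κ g ψ z z b * f z ^ 2 := by
  filter_upwards [(ae_densityMeasure_iff hf0 hf).1 hfS] with z hz
  rcases eq_or_ne (f z) 0 with hfz | hfz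
  · simp [hfz]
  · rw [condMean_localLogLik, Set.indicator_of_mem (hz hfz)]

lemma integrable_phi_mul_sq (hf0 : ∀ z, 0 ≤ f z) (hf : Measurable f)
    (hfS : ∀ᵐ z ∂(densityMeasure f), z ∈ S) (hg : ∀ t, g t ∈ Set.Ioo (-1 : ℝ) 1)
    (hS : MeasurableSet S) (hq : ContinuousOn (fun x => q g ψ x b) S) (hε : 0 < ε)
    (hint : ∫⁻ x, envelope S ε f (fun x y => phi κ g ψ x y b) x ≠ ∞) :
    Integrable fun z => phi κ g ψ z z b * f z ^ 2 := by
  obtain ⟨B, -, hB⟩ := exists_measurable_abs_localLogLik_le hg hS hq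
  have henv := ne_top_of_le_ne_top hint
    (lintegral_mono (envelope_condMean_abs_localLogLik_le hg ε f))
  exact (integrable_condMean_mul_sq hε hf0 hf hfS (measurable_localLogLik hg hS hq) hB henv).congr
    (condMean_localLogLik_mul_sq_ae_eq hf0 hf hfS)

variable {Ω : Type*} [MeasurableSpace Ω] {P : Measure Ω} {Z : ℕ → Ω → Vec p} {X : ℕ → Ω → ℝ × ℝ}

lemma IsIIDSample.ae_fst_mem_iff
    (hY : IsIIDSample (fun i ω => (Z i ω, X i ω)) (densityMeasure f ⊗ₘ κ) P)
    (hS : MeasurableSet S) (i : ℕ) :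
    (∀ᵐ ω ∂P, Z i ω ∈ S) ↔ ∀ᵐ z ∂(densityMeasure f), z ∈ S := by
  have hlaw : P.map (Z i) = densityMeasure f := by
    rw [← Measure.fst_compProd (densityMeasure f) κ, ← hY.law i,
      Measure.fst_map_prodMk (hY.measurable i).snd]
  rw [← hlaw]
  exact (ae_map_iff (hY.measurable i).fst.aemeasurable hS).symm

theorem tendstoInMeasure_Ln {K : Vec p → ℝ} {m : ℕ} {h : ℕ → ℝ}
    (hY : IsIIDSample (fun i ω => (Z i ω, X i ω)) (densityMeasure f ⊗ₘ κ) P)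
    (hK : IsKernelOfOrder K m) (hh : Tendsto h atTop (𝓝[>] 0))
    (hrate : Tendsto (fun n : ℕ => (n : ℝ) ^ 2 * h n ^ p) atTop atTop)
    (hf0 : ∀ z, 0 ≤ f z) (hf : Continuous f) (hfS : ∀ᵐ z ∂(densityMeasure f), z ∈ S)
    (hg : ∀ t, g t ∈ Set.Ioo (-1 : ℝ) 1) (hS : MeasurableSet S)
    (hphi : ∀ x ∈ S, ContinuousOn (fun y => phi κ g ψ x y b) S)
    (hq : ContinuousOn (fun x => q g ψ x b) S) (hε : 0 < ε)
    (hint : ∫⁻ x, envelope S ε f (fun x y => phi κ g ψ x y b) x ≠ ∞) :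
    TendstoInMeasure P (fun n ω => Ln K g ψ n (h n) (fun i => Z i ω) (fun i => X i ω) b) atTop
      (fun _ => Linf κ g ψ f b) := by
  obtain ⟨B, hBm, hB⟩ := exists_measurable_abs_localLogLik_le hg hS hq
  have henv := ne_top_of_le_ne_top hint
    (lintegral_mono (envelope_condMean_abs_localLogLik_le hg ε f))
  have hcont : ∀ x ∈ S, ContinuousOn (condMean κ (localLogLik g ψ S b) x) S := fun x hx => by
    rw [condMean_localLogLik, Set.indicator_of_mem hx]
    exact hphi x hx
  have hlim := tendstoInMeasure_uStat_pairKernel hY hK hh hrate hf0 hf hfS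
    (measurable_localLogLik hg hS hq) hBm hB hcont hε henv
  rw [integral_congr_ae (condMean_localLogLik_mul_sq_ae_eq hf0 hf.measurable hfS)] at hlim
  refine hlim.congr_left fun n => ?_
  filter_upwards [ae_all_iff.2 fun i => (hY.ae_fst_mem_iff hS i).2 hfS] with ω hω
  exact (Ln_eq_uStat hω n).symm

end Model

section Identification

variable {p d : ℕ}

lemma prod_ties_eq_zero {μ : Measure (ℝ × ℝ)} [SFinite μ] (hμ : μ ≪ volume) :
    (μ.prod μ) {u | (u.2.1 - u.1.1) * (u.2.2 - u.1.2) = 0} = 0 := by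
  rw [Measure.measure_prod_null (measurableSet_eq_fun (by fun_prop) (by fun_prop))]
  refine ae_of_all _ fun x => ?_
  refine hμ (measure_mono_null (t := ({x.1} ×ˢ Set.univ) ∪ (Set.univ ×ˢ {x.2}))
    (fun y (hy : (y.1 - x.1) * (y.2 - x.2) = 0) => ?_) ?_)
  · rcases mul_eq_zero.1 hy with hfst | hsnd
    · exact Or.inl ⟨sub_eq_zero.1 hfst, trivial⟩
    · exact Or.inr ⟨trivial, sub_eq_zero.1 hsnd⟩
  · rw [measure_union_null_iff, Measure.volume_eq_prod, Measure.prod_prod, Measure.prod_prod]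
    simp

variable {κ : Kernel (Vec p) (ℝ × ℝ)} {g : ℝ → ℝ} {ψ : Vec p → Vec d} {βstar : Vec d}

lemma IntegrabilityTwo.lintegral_envelope_phi_lt_top {f : Vec p → ℝ} {S : Set (Vec p)} {b : Vec d}
    {ε : ℝ} (hint : IntegrabilityTwo κ g ψ S f b ε) :
    ∫⁻ z, envelope S ε f (fun x y => phi κ g ψ x y b) z < ∞ := by
  refine (lintegral_mono fun z => ?_).trans_lt hint
  rw [envelope]
  gcongr
  rw [add_assoc]
  exact le_self_add

variable [IsMarkovKernel κ]

lemma condTau_eq_two_mul_prob2_sub_one {z : Vec p} (hz : κ z ≪ volume) :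
    condTau κ z = 2 * prob2 κ z z - 1 := by
  have hcompl : ((κ z).prod (κ z)).real {u | Discordant u.1 u.2} =
      ((κ z).prod (κ z)).real {u | Concordant u.1 u.2}ᶜ := by
    have hties : ∀ᵐ u ∂((κ z).prod (κ z)), (u.2.1 - u.1.1) * (u.2.2 - u.1.2) ≠ 0 :=
      measure_eq_zero_iff_ae_notMem.1 (prod_ties_eq_zero hz)
    refine measureReal_congr ?_
    filter_upwards [hties] with u hu
    exact propext (hu.le_iff_lt.symm.trans not_lt.symm)
  rw [condTau, hcompl, probReal_compl_eq_one_sub measurableSet_concordant, prob2]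
  ring

lemma mul_log_sub_mul_log_le_sub {s t : ℝ} (hs : 0 ≤ s) (ht : 0 < t) :
    s * Real.log t - s * Real.log s ≤ t - s := by
  rcases hs.eq_or_lt with rfl | hs
  · simpa using ht.le
  calc s * Real.log t - s * Real.log s = s * Real.log (t / s) := by
        rw [Real.log_div ht.ne' hs.ne', mul_sub]
    _ ≤ s * (t / s - 1) := by
        gcongr
        exact Real.log_le_sub_one_of_pos (div_pos ht hs)
    _ = t - s := by field_simp

lemma mul_log_add_one_sub_mul_log_le {s t : ℝ} (hs : s ∈ Set.Icc (0 : ℝ) 1)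
    (ht : t ∈ Set.Ioo (0 : ℝ) 1) :
    s * Real.log t + (1 - s) * Real.log (1 - t) ≤
      s * Real.log s + (1 - s) * Real.log (1 - s) := by
  have hone := mul_log_sub_mul_log_le_sub hs.1 ht.1
  have hzero := mul_log_sub_mul_log_le_sub (sub_nonneg.2 hs.2) (sub_pos.2 ht.2)
  linarith

lemma phi_self_le_of_condTau_eq (hg : ∀ t, g t ∈ Set.Ioo (-1 : ℝ) 1) {z : Vec p}
    (hz : κ z ≪ volume) (hmodel : condTau κ z = g (∑ k, ψ z k * βstar k)) (b : Vec d) :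
    phi κ g ψ z z b ≤ phi κ g ψ z z βstar := by
  have hprob : prob2 κ z z = q g ψ z βstar := by
    rw [condTau_eq_two_mul_prob2_sub_one hz] at hmodel
    rw [q]
    linarith
  rw [phi, phi, hprob]
  exact mul_log_add_one_sub_mul_log_le (Set.Ioo_subset_Icc_self (q_mem_Ioo hg z βstar))
    (q_mem_Ioo hg z b)

lemma isArgmax_Linf_of_condTau_eq {f : Vec p → ℝ} {S : Set (Vec p)} (hf0 : ∀ z, 0 ≤ f z)
    (hf : Measurable f) (hfS : ∀ᵐ z ∂(densityMeasure f), z ∈ S) (hκ : ∀ z ∈ S, κ z ≪ volume)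
    (hg : ∀ t, g t ∈ Set.Ioo (-1 : ℝ) 1)
    (hmodel : ∀ z ∈ S, condTau κ z = g (∑ k, ψ z k * βstar k))
    (hint : ∀ b, Integrable fun z => phi κ g ψ z z b * f z ^ 2) :
    IsArgmax (Linf κ g ψ f) βstar := by
  refine fun b => integral_mono_ae (hint b) (hint βstar) ?_
  filter_upwards [(ae_densityMeasure_iff hf0 hf).1 hfS] with z hz
  rcases eq_or_ne (f z) 0 with hfz | hfz
  · simp [hfz]
  · exact mul_le_mul_of_nonneg_right
      (phi_self_le_of_condTau_eq hg (hκ z (hz hfz)) (hmodel z (hz hfz)) b) (sq_nonneg _)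

lemma IsArgmax.eq_of_isUniqueArgmax {F : Vec d → ℝ} {b b' : Vec d} (hb' : IsArgmax F b')
    (hb : IsUniqueArgmax F b) : b = b' := by
  by_contra hne
  exact (hb b' (Ne.symm hne)).not_ge (hb' b)

lemma convexOn_l1 : ConvexOn ℝ Set.univ (l1 : Vec d → ℝ) := by
  refine ⟨convex_univ, fun x _ y _ s t hs ht _ => ?_⟩
  simp only [l1, smul_eq_mul, Finset.mul_sum, ← Finset.sum_add_distrib]
  refine Finset.sum_le_sum fun k _ => ?_
  calc |(s • x + t • y) k| ≤ |s * x k| + |t * y k| := abs_add_le _ _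
    _ = s * |x k| + t * |y k| := by rw [abs_mul, abs_mul, abs_of_nonneg hs, abs_of_nonneg ht]

end Identification

end CKT

theorem theorem1_general {Ω : Type*} [MeasurableSpace Ω] (P : Measure Ω)
    {p d : ℕ} (Z : ℕ → Ω → CKT.Vec p) (X : ℕ → Ω → ℝ × ℝ)
    (f : CKT.Vec p → ℝ) (hf0 : ∀ z, 0 ≤ f z) (hf : Continuous f)
    (κ : Kernel (CKT.Vec p) (ℝ × ℝ)) [IsMarkovKernel κ]
    (hY : CKT.IsIIDSample (fun i ω => (Z i ω, X i ω)) (CKT.densityMeasure f ⊗ₘ κ) P)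
    (S : Set (CKT.Vec p)) (hS : MeasurableSet S) (hZS : ∀ᵐ ω ∂P, Z 0 ω ∈ S)
    (hκ : ∀ z ∈ S, κ z ≪ volume)
    (g : ℝ → ℝ) (hg : ∀ t, g t ∈ Set.Ioo (-1 : ℝ) 1) (ψ : CKT.Vec p → CKT.Vec d)
    (βstar : CKT.Vec d) (hmodel : ∀ z ∈ S, CKT.condTau κ z = g (∑ k, ψ z k * βstar k))
    (m : ℕ) (K : CKT.Vec p → ℝ) (hK : CKT.IsKernelOfOrder K m)
    (h : ℕ → ℝ) (hh : Tendsto h atTop (𝓝[>] 0))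
    (hrate : Tendsto (fun n : ℕ => (n : ℝ) ^ 2 * h n ^ p) atTop atTop)
    (lam : ℕ → ℝ) (hlam : ∀ n, 0 ≤ lam n) (lamInf : ℝ)
    (hlamInf : Tendsto lam atTop (𝓝 lamInf))
    (hphi : ∀ x ∈ S, ∀ b, ContinuousOn (fun y => CKT.phi κ g ψ x y b) S)
    (hq : ∀ b, ContinuousOn (fun x => CKT.q g ψ x b) S)
    (hint : ∀ b, ∃ ε > 0, ∫⁻ z, CKT.envelope S ε f (fun x y => CKT.phi κ g ψ x y b) z < ∞)
    (hconcave : ∀ n, ∀ᵐ ω ∂P, ConcaveOn ℝ Set.univ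
      (CKT.Ln K g ψ n (h n) (fun i => Z i ω) (fun i => X i ω)))
    (βhat : ℕ → Ω → CKT.Vec d)
    (hβhat : ∀ n, ∀ᵐ ω ∂P,
      (∃ b, CKT.IsArgmax (fun b => CKT.Ln K g ψ n (h n) (fun i => Z i ω) (fun i => X i ω) b
        - lam n * CKT.l1 b) b) →
      CKT.IsArgmax (fun b => CKT.Ln K g ψ n (h n) (fun i => Z i ω) (fun i => X i ω) b
        - lam n * CKT.l1 b) (βhat n ω))
    (βlim : CKT.Vec d)
    (hβlim : CKT.IsUniqueArgmax (fun b => CKT.Linf κ g ψ f b - lamInf * CKT.l1 b) βlim) :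
    (∀ b : CKT.Vec d, Integrable (fun z => CKT.phi κ g ψ z z b * f z ^ 2)) ∧
    TendstoInMeasure P βhat atTop (fun _ => βlim) ∧
    (lamInf = 0 → βlim = βstar) := by
  have := hY.isProbabilityMeasure
  have hfS := (hY.ae_fst_mem_iff hS 0).1 hZS
  have hinteg : ∀ b, Integrable (fun z => CKT.phi κ g ψ z z b * f z ^ 2) := fun b =>
    let ⟨_, hε, henv⟩ := hint b
    CKT.integrable_phi_mul_sq hf0 hf.measurable hfS hg hS (hq b) hε henv.ne
  refine ⟨hinteg, ?_, fun hlam0 => ?_⟩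
  · refine CKT.tendstoInMeasure_argmax_of_concave (fun b => ?_) (fun n => ?_) hβhat hβlim
    · obtain ⟨ε, hε, henv⟩ := hint b
      simpa only [sub_eq_add_neg] using CKT.tendstoInMeasure_add_of_tendsto
        (CKT.tendstoInMeasure_Ln hY hK hh hrate hf0 hf hfS hg hS (fun x hx => hphi x hx b) (hq b)
          hε henv.ne) (hlamInf.mul_const (CKT.l1 b)).neg
    · filter_upwards [hconcave n] with ω hω using hω.sub (CKT.convexOn_l1.smul (hlam n))
  · refine (CKT.isArgmax_Linf_of_condTau_eq hf0 hf.measurable hfS hκ hg hmodel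
      hinteg).eq_of_isUniqueArgmax ?_
    simpa only [hlam0, zero_mul, sub_zero] using hβlim

theorem theorem1 {Ω : Type*} [MeasurableSpace Ω] (P : Measure Ω) [IsProbabilityMeasure P]
    {p d : ℕ}
    -- the i.i.d. sample `(Z i, X i)`
    (Z : ℕ → Ω → CKT.Vec p) (X : ℕ → Ω → ℝ × ℝ)
    (hZ : ∀ i, Measurable (Z i)) (hX : ∀ i, Measurable (X i))
    (hindep : iIndepFun (fun i ω => (Z i ω, X i ω)) P)
    -- `f` is the density of `Z` and `κ z` the conditional law of `X` given `Z = z`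
    (f : CKT.Vec p → ℝ) (hf : ∀ z, 0 ≤ f z)
    (κ : Kernel (CKT.Vec p) (ℝ × ℝ)) [IsMarkovKernel κ]
    (hlaw : ∀ i, P.map (fun ω => (Z i ω, X i ω)) =
      (volume.withDensity fun z => ENNReal.ofReal (f z)) ⊗ₘ κ)
    -- the set `S` in which `Z` takes its values
    (S : Set (CKT.Vec p)) (hS : MeasurableSet S) (hZS : ∀ i, ∀ᵐ ω ∂P, Z i ω ∈ S)
    (hκ : ∀ z ∈ S, κ z ≪ volume)
    -- the single-index model
    (g : ℝ → ℝ) (hg : ∀ t, g t ∈ Set.Ioo (-1 : ℝ) 1) (ψ : CKT.Vec p → CKT.Vec d)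
    (βstar : CKT.Vec d) (hmodel : ∀ z ∈ S, CKT.condTau κ z = g (∑ k, ψ z k * βstar k))
    -- kernel, bandwidths, penalties
    (m : ℕ) (hm : 2 ≤ m) (K : CKT.Vec p → ℝ) (hK : CKT.IsKernelOfOrder K m)
    (h : ℕ → ℝ) (hpos : ∀ n, 0 < h n) (hzero : Tendsto h atTop (𝓝 0))
    (hrate : Tendsto (fun n : ℕ => (n : ℝ) ^ 2 * h n ^ p) atTop atTop)
    (lam : ℕ → ℝ) (hlam : ∀ n, 0 ≤ lam n) (lamInf : ℝ)
    (hlamInf : Tendsto lam atTop (𝓝 lamInf))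
    -- regularity and integrability
    (hreg : CKT.Regular κ g ψ S f m)
    (hint : ∀ b : CKT.Vec d, ∃ ε > 0,
      CKT.IntegrabilityOne κ g ψ S f b ε ∧ CKT.IntegrabilityTwo κ g ψ S f b ε)
    (hconcave : ∀ n, ∀ᵐ ω ∂P, ConcaveOn ℝ Set.univ
      (CKT.Ln K g ψ n (h n) (fun i => Z i ω) (fun i => X i ω)))
    -- the estimator: a maximizer of the penalized criterion, whenever there is one
    (βhat : ℕ → Ω → CKT.Vec d)
    (hβhat : ∀ n, ∀ᵐ ω ∂P,
      (∃ b, CKT.IsArgmax (fun b => CKT.Ln K g ψ n (h n) (fun i => Z i ω) (fun i => X i ω) b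
        - lam n * CKT.l1 b) b) →
      CKT.IsArgmax (fun b => CKT.Ln K g ψ n (h n) (fun i => Z i ω) (fun i => X i ω) b
        - lam n * CKT.l1 b) (βhat n ω))
    -- the maximizer of the limit criterion
    (βlim : CKT.Vec d)
    (hβlim : CKT.IsUniqueArgmax (fun b => CKT.Linf κ g ψ f b - lamInf * CKT.l1 b) βlim) :
    (∀ b : CKT.Vec d, Integrable (fun z => CKT.phi κ g ψ z z b * f z ^ 2)) ∧
    TendstoInMeasure P βhat atTop (fun _ => βlim) ∧
    (lamInf = 0 → βlim = βstar) := by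
  have hY : CKT.IsIIDSample (fun i ω => (Z i ω, X i ω)) (CKT.densityMeasure f ⊗ₘ κ) P :=
    ⟨fun i => (hZ i).prodMk (hX i), hindep, hlaw⟩
  exact theorem1_general P Z X f hf hreg.density.continuous κ hY S hS (hZS 0) hκ g hg ψ βstar hmodel
    m K hK h (tendsto_nhdsWithin_iff.2 ⟨hzero, .of_forall hpos⟩) hrate lam hlam lamInf hlamInf
    hreg.phi_continuous hreg.q_continuous
    (fun b => let ⟨ε, hε, _, htwo⟩ := hint b; ⟨ε, hε, htwo.lintegral_envelope_phi_lt_top⟩)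
    hconcave βhat hβhat βlim hβlim
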